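/- Let $n\ge 3$ and let $\mathrm{Cr}_n$ be the Cremona group of birational automorphisms of $\mathbb P^n$ over $\mathbb C$, with homogeneous coordinates $X_0,\dots,X_n$; write $X=(X_1,\dots,X_n)$. An element $f\in\mathrm{Cr}_n$ is written $f=[f_0:\dots:f_n]$ with homogeneous polynomials $f_i$ of one degree (not necessarily coprime). Let $G$ be the set of all $f\in \mathrm{Cr}_n$ such that both $f$ and $f^{-1}$ admit a representation of the form $$f_0=c_0X_0^{e}X^{I_0}+(\text{terms of lower degree in }X_0),\qquad f_j=c_jX_0^{e-1}X^{I_j}+(\text{terms of lower degree in }X_0)\quad(1\le j\le n)$$ with $e\ge 1$, $c_i\in\mathbb C^*$ and exponent vectors $I_i\in\mathbb Z_{\ge0}^n$. For $f\in G$ let $\rho(f)=M_f\in \mathbf M_n(\mathbb Z)$ be the matrix whose $j$-th column is $I_j-I_0$ (it does not depend on the representation), and let $\Lambda_n=\ker\rho=\{f\in G: M_f=\mathrm{Id}\}$. Let $\mathrm{SAut}_{n-1}$ be the group of polynomial automorphisms of $\mathbb C^{n-1}$ with Jacobian determinant $1$, where $\mathbb C^{n-1}$ is the chart $X_1\ne0$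 of the hyperplane $\Pi=(X_0=0)$, with coordinates $X_j/X_1$, $2\le j\le n$. Then there are a subgroup $S$ of $\mathrm{Cr}_n$ contained in $\Lambda_n$ and a surjective group homomorphism $\xi:S\twoheadrightarrow \mathrm{SAut}_{n-1}$ given by restriction to $\Pi$: every $f\in S$ is defined at the generic point of $\Pi$, maps $\Pi$ to itself, and $f|_{\Pi}$ is on the chart $X_1\neq 0$ the polynomial automorphism $\xi(f)$. Moreover, $S$ can be chosen to contain every element of $\Lambda_n$ that restricts to an element of $\mathrm{SAut}_{n-1}$ on $\Pi$ in this sense and that has the form $$X_0\mapsto \alpha_0X_0^{d}+\alpha X_0X_1^{d-1},\qquad X_1\mapsto\alpha_1X_0^{d-1}X_1+\beta X_1^{d},\qquad X_j\mapsto \alpha_jX_0^{d-1}X_j+\Lambda_j^*(X)\quad(2\le j\le n)$$ with $d\ge1$, $\alpha_i,\alpha,\beta\in\mathbb C$ and $\Lambda_j^*\in\mathbb C[X_1,\dots,X_n]$ homogeneous of degree $d$. -/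

import Mathlib

open MvPolynomial

noncomputable section

namespace CremonaGrp

/-- The field `ℂ(x₁, …, xₙ)` of rational functions on `ℙⁿ`. The variable with index `j : Fin n`
is the function `X_{j+1} / X_0`. -/
abbrev RatFun (n : ℕ) : Type := FractionRing (MvPolynomial (Fin n) ℂ)

/-- The Cremona group of birational automorphisms of `ℂⁿ` (equivalently of `ℙⁿ`). A birational
automorphism `f` is given by its pullback `f^*`, an automorphism of the field of rational functions
over `ℂ`; since `(f ∘ g)^* = g^* ∘ f^*`, the group whose product is the composition of maps is the
opposite of the group of these field automorphisms. -/
abbrev Cremona (n : ℕ) : Type := (RatFun n ≃ₐ[ℂ] RatFun n)ᵐᵒᵖ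

/-- The pullback of rational functions along a birational automorphism. -/
def pullback {n : ℕ} (f : Cremona n) : RatFun n ≃ₐ[ℂ] RatFun n := f.unop

/-- The coordinate function `X_{j+1} / X_0`. -/
def coordFun {n : ℕ} (j : Fin n) : RatFun n := algebraMap (MvPolynomial (Fin n) ℂ) (RatFun n) (X j)

/-- Dehomogenization `P(X_0, …, X_n) ↦ P(1, x_1, …, x_n)`, with values in rational functions. -/
def dehom (n : ℕ) : MvPolynomial (Fin (n + 1)) ℂ →ₐ[ℂ] RatFun n :=
  aeval (Fin.cons 1 coordFun : Fin (n + 1) → RatFun n)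

/-- `f` is the map `[X_0 : … : X_n] ↦ [F_0 : … : F_n]`, where `F_0, …, F_n` are homogeneous
polynomials of one degree, not necessarily coprime. -/
def Represents {n : ℕ} (f : Cremona n) (F : Fin (n + 1) → MvPolynomial (Fin (n + 1)) ℂ) : Prop :=
  (∃ D : ℕ, ∀ i, (F i).IsHomogeneous D) ∧ F 0 ≠ 0 ∧
    ∀ j : Fin n, pullback f (coordFun j) = dehom n (F j.succ) / dehom n (F 0)

/-- `p = α X_0^e X^I + (terms of degree less than e in X_0)` with `α ≠ 0`, where
`X = (X_1, …, X_n)`. Here `finSuccEquiv` views `p` as a polynomial in `X_0` with coefficients in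
`ℂ[X_1, …, X_n]`. -/
def LeadsWith {n : ℕ} (p : MvPolynomial (Fin (n + 1)) ℂ) (e : ℕ) (I : Fin n →₀ ℕ) : Prop :=
  (finSuccEquiv ℂ n p).natDegree = e ∧
    ∃ α : ℂ, α ≠ 0 ∧ (finSuccEquiv ℂ n p).leadingCoeff = monomial I α

/-- `f = [F_0 : … : F_n]`, where for some `d ≥ 1` and nonzero constants `α_i`
* `F_0 = α_0 X_0^d X^{I_0} + (terms of lower degree in X_0)`,
* `F_j = α_j X_0^{d-1} X^{I_j} + (terms of lower degree in X_0)` for `1 ≤ j ≤ n`.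
(The number `d` of this comment is `d + 1` in the code.) -/
def IsMonomialAtInfinity {n : ℕ} (f : Cremona n)
    (F : Fin (n + 1) → MvPolynomial (Fin (n + 1)) ℂ) (I : Fin (n + 1) → Fin n →₀ ℕ) : Prop :=
  Represents f F ∧
    ∃ d : ℕ, LeadsWith (F 0) (d + 1) (I 0) ∧ ∀ j : Fin n, LeadsWith (F j.succ) d (I j.succ)

/-- The group `G`: all `f` such that both `f` and `f⁻¹` have the above shape. -/
def G (n : ℕ) : Set (Cremona n) :=
  {f | (∃ F I, IsMonomialAtInfinity f F I) ∧ ∃ F I, IsMonomialAtInfinity f⁻¹ F I}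

/-- The integer matrix whose `j`-th column is `I_j - I_0`, `1 ≤ j ≤ n`. -/
def expMatrix {n : ℕ} (I : Fin (n + 1) → Fin n →₀ ℕ) : Matrix (Fin n) (Fin n) ℤ :=
  Matrix.of fun i j => (I j.succ i : ℤ) - (I 0 i : ℤ)

/-- The map `ρ : G → M_n(ℤ)`, `f ↦ M_f`, where `M_f` has the columns `I_j - I_0`.
It does not depend on the chosen polynomials, see `rho_eq`. -/
def rho {n : ℕ} (f : G n) : Matrix (Fin n) (Fin n) ℤ :=
  expMatrix f.2.1.choose_spec.choose

/-- The kernel of `ρ`. -/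
def kerRho (n : ℕ) : Set (Cremona n) := {f | ∃ h : f ∈ G n, rho ⟨f, h⟩ = 1}

/-- The group of polynomial automorphisms of `ℂ^m`. Again `φ` is given by its pullback on
`ℂ[x_1, …, x_m]`, and the product is the composition of maps. -/
abbrev PolyAut (m : ℕ) : Type := (MvPolynomial (Fin m) ℂ ≃ₐ[ℂ] MvPolynomial (Fin m) ℂ)ᵐᵒᵖ

/-- The `j`-th component `φ_j` of a polynomial automorphism `φ = (φ_1, …, φ_m)`. -/
def comp {m : ℕ} (φ : PolyAut m) (j : Fin m) : MvPolynomial (Fin m) ℂ := φ.unop (X j)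

/-- The Jacobi matrix `(∂φ_i / ∂x_j)`. -/
def jacobian {m : ℕ} (φ : PolyAut m) : Matrix (Fin m) (Fin m) (MvPolynomial (Fin m) ℂ) :=
  Matrix.of fun i j => pderiv j (comp φ i)

/-- The chain rule. -/
theorem pderiv_algEquiv {m : ℕ} (e : MvPolynomial (Fin m) ℂ ≃ₐ[ℂ] MvPolynomial (Fin m) ℂ)
    (p : MvPolynomial (Fin m) ℂ) (j : Fin m) :
    pderiv j (e p) = ∑ k, e (pderiv k p) * pderiv j (e (X k)) := by
  induction p using MvPolynomial.induction_on with
  | C a =>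
    have : e (C a) = C a := e.commutes a
    simp [this]
  | add p q hp hq => simp [hp, hq, add_mul, Finset.sum_add_distrib]
  | mul_X p i hp =>
    simp only [map_mul, Derivation.leibniz, hp, smul_eq_mul, map_add, pderiv_X, add_mul,
      Finset.sum_add_distrib, Finset.mul_sum]
    congr 1
    · rw [Finset.sum_eq_single i]
      · simp
      · intro b _ hb
        simp [hb.symm]
      · simp
    · exact Finset.sum_congr rfl fun _ _ => by ring

theorem jacobian_mul {m : ℕ} (φ ψ : PolyAut m) :
    jacobian (φ * ψ) = (jacobian φ).map ψ.unop * jacobian ψ := by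
  ext1 i j
  simp only [jacobian, comp, Matrix.mul_apply, Matrix.of_apply, Matrix.map_apply]
  exact pderiv_algEquiv ψ.unop (φ.unop (X i)) j

theorem det_jacobian_mul {m : ℕ} (φ ψ : PolyAut m) :
    (jacobian (φ * ψ)).det = ψ.unop (jacobian φ).det * (jacobian ψ).det := by
  rw [jacobian_mul, Matrix.det_mul]
  congr 1
  exact (AlgEquiv.map_det ψ.unop (jacobian φ)).symm

theorem det_jacobian_one (m : ℕ) : (jacobian (1 : PolyAut m)).det = 1 := by
  have : jacobian (1 : PolyAut m) = 1 := by
    ext1 i j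
    simp [jacobian, comp, pderiv_X, Matrix.one_apply, Pi.single_apply]
  rw [this, Matrix.det_one]

/-- The group of polynomial automorphisms of `ℂ^m` with Jacobian determinant `1`. -/
def SAut (m : ℕ) : Subgroup (PolyAut m) where
  carrier := {φ | (jacobian φ).det = 1}
  one_mem' := det_jacobian_one m
  mul_mem' := by
    intro φ ψ hφ hψ
    change (jacobian φ).det = 1 at hφ
    change (jacobian ψ).det = 1 at hψ
    change (jacobian (φ * ψ)).det = 1
    rw [det_jacobian_mul, hφ, hψ, map_one, one_mul]
  inv_mem' := by
    intro φ hφ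
    change (jacobian φ).det = 1 at hφ
    change (jacobian φ⁻¹).det = 1
    have h := det_jacobian_mul φ φ⁻¹
    rw [mul_inv_cancel, det_jacobian_one, hφ, map_one, one_mul] at h
    exact h.symm

/-- The index `j + 2`: the coordinates of `ℂ^{n-1}` are numbered `2, …, n`. -/
def idx {n : ℕ} (j : Fin (n - 1)) : Fin (n + 1) := ⟨j.1 + 2, by omega⟩

/-- The restriction of a polynomial to the affine chart `X_1 ≠ 0` of the hyperplane `X_0 = 0`:
`P(X_0, …, X_n) ↦ P(0, 1, x_2, …, x_n)`. -/
def restrict (n : ℕ) : MvPolynomial (Fin (n + 1)) ℂ →ₐ[ℂ] MvPolynomial (Fin (n - 1)) ℂ :=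
  aeval fun i : Fin (n + 1) =>
    if h : 2 ≤ i.1 then X (⟨i.1 - 2, by omega⟩ : Fin (n - 1)) else if i.1 = 1 then 1 else 0

/-- The map `f` is defined at the generic point of the hyperplane `X_0 = 0`, maps this hyperplane
to itself, and its restriction to the chart `X_1 ≠ 0`, with the coordinates `x_j = X_j / X_1`,
`2 ≤ j ≤ n`, is the polynomial automorphism `φ`. -/
def RestrictsTo {n : ℕ} (f : Cremona n) (φ : PolyAut (n - 1)) : Prop :=
  ∃ F, Represents f F ∧ restrict n (F 0) = 0 ∧ restrict n (F 1) ≠ 0 ∧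
    ∀ j : Fin (n - 1), restrict n (F (idx j)) = comp φ j * restrict n (F 1)

/-- `f` has the form
* `X_0 ↦ α_0 X_0^d + a X_0 X_1^{d-1}`,
* `X_1 ↦ α_1 X_0^{d-1} X_1 + b X_1^d`,
* `X_j ↦ α_j X_0^{d-1} X_j + L_j(X_1, …, X_n)` for `2 ≤ j ≤ n`,
with `d ≥ 1` and `L_j` homogeneous of degree `d`. -/
def HasTypicalForm {n : ℕ} (f : Cremona n) : Prop :=
  ∃ (d : ℕ) (α : Fin (n + 1) → ℂ) (a b : ℂ) (L : Fin (n - 1) → MvPolynomial (Fin n) ℂ)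
    (F : Fin (n + 1) → MvPolynomial (Fin (n + 1)) ℂ),
    1 ≤ d ∧ (∀ j, (L j).IsHomogeneous d) ∧ Represents f F ∧
    F 0 = C (α 0) * X 0 ^ d + C a * X 0 * X 1 ^ (d - 1) ∧
    F 1 = C (α 1) * X 0 ^ (d - 1) * X 1 + C b * X 1 ^ d ∧
    ∀ j : Fin (n - 1),
      F (idx j) = C (α (idx j)) * X 0 ^ (d - 1) * X (idx j) + rename Fin.succ (L j)

theorem dehom_injOn {n D : ℕ} {p q : MvPolynomial (Fin (n + 1)) ℂ} (hp : p.IsHomogeneous D)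
    (hq : q.IsHomogeneous D) (h : dehom n p = dehom n q) : p = q := by
  have key : ∀ r : MvPolynomial (Fin (n + 1)) ℂ, dehom n r =
      algebraMap (MvPolynomial (Fin n) ℂ) (RatFun n) ((finSuccEquiv ℂ n r).eval 1) := by
    intro r
    induction r using MvPolynomial.induction_on with
    | C a =>
      have h1 : dehom n (C a) = algebraMap ℂ (RatFun n) a := (dehom n).commutes a
      rw [h1, finSuccEquiv_apply]
      simp only [eval₂Hom_C, RingHom.coe_comp, Function.comp_apply, Polynomial.eval_C]
      exact IsScalarTower.algebraMap_apply ℂ (MvPolynomial (Fin n) ℂ) (RatFun n) a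
    | add p q hp hq => simp [hp, hq]
    | mul_X p i hp =>
      rw [map_mul, hp]
      refine Fin.cases ?_ (fun j => ?_) i
      · simp [dehom, finSuccEquiv_X_zero]
      · simp [dehom, finSuccEquiv_X_succ, coordFun]
  rw [key, key] at h
  have h2 := IsFractionRing.injective (MvPolynomial (Fin n) ℂ) (RatFun n) h
  have hr : (p - q).IsHomogeneous D := hp.sub hq
  rw [← sub_eq_zero] at h2 ⊢
  rw [← Polynomial.eval_sub, ← map_sub] at h2
  generalize p - q = r at h2 hr
  ext m
  rw [coeff_zero]
  by_contra hm
  have hmD : m.degree = D := by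
    rw [Finsupp.degree_eq_weight_one (R := ℕ)]
    exact hr hm
  have hc : coeff (Finsupp.tail m) ((finSuccEquiv ℂ n r).eval 1) = coeff m r := by
    rw [Polynomial.eval_eq_sum, Polynomial.sum_def, coeff_sum]
    simp only [one_pow, mul_one, finSuccEquiv_coeff_coeff]
    rw [Finset.sum_eq_single (m 0)]
    · rw [Finsupp.cons_tail]
    · intro k _ hk
      by_contra hne
      have h3 : (Finsupp.cons k (Finsupp.tail m)).degree = D := by
        rw [Finsupp.degree_eq_weight_one (R := ℕ)]
        exact hr hne
      rw [← Finsupp.cons_tail m] at hmD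
      simp only [Finsupp.degree_eq_sum, Fin.sum_univ_succ, Finsupp.cons_zero,
        Finsupp.cons_succ] at h3 hmD
      omega
    · intro h0
      have := Polynomial.notMem_support_iff.mp h0
      rw [← finSuccEquiv_coeff_coeff, this, coeff_zero]
  rw [h2, coeff_zero] at hc
  exact hm hc.symm

theorem LeadsWith.mul {n e e' : ℕ} {p q : MvPolynomial (Fin (n + 1)) ℂ} {I J : Fin n →₀ ℕ}
    (hp : LeadsWith p e I) (hq : LeadsWith q e' J) : LeadsWith (p * q) (e + e') (I + J) := by
  obtain ⟨h1, a, ha, h2⟩ := hp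
  obtain ⟨h3, b, hb, h4⟩ := hq
  have hp0 : finSuccEquiv ℂ n p ≠ 0 := fun h => by
    rw [h, Polynomial.leadingCoeff_zero] at h2
    exact ha (monomial_eq_zero.mp h2.symm)
  have hq0 : finSuccEquiv ℂ n q ≠ 0 := fun h => by
    rw [h, Polynomial.leadingCoeff_zero] at h4
    exact hb (monomial_eq_zero.mp h4.symm)
  refine ⟨by rw [map_mul, Polynomial.natDegree_mul hp0 hq0, h1, h3], a * b, mul_ne_zero ha hb, ?_⟩
  rw [map_mul, Polynomial.leadingCoeff_mul, h2, h4, monomial_mul]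

theorem LeadsWith.unique {n e e' : ℕ} {p : MvPolynomial (Fin (n + 1)) ℂ} {I J : Fin n →₀ ℕ}
    (hp : LeadsWith p e I) (hq : LeadsWith p e' J) : I = J := by
  obtain ⟨-, a, ha, h2⟩ := hp
  obtain ⟨-, b, hb, h4⟩ := hq
  rw [h2, monomial_eq_monomial_iff] at h4
  rcases h4 with h | h
  · exact h.1
  · exact absurd h.1 ha

theorem Represents.cross {n : ℕ} {f : Cremona n} {F F' : Fin (n + 1) → MvPolynomial (Fin (n + 1)) ℂ}
    (h : Represents f F) (h' : Represents f F') (j : Fin n) :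
    F j.succ * F' 0 = F' j.succ * F 0 := by
  obtain ⟨⟨D, hD⟩, h0, hj⟩ := h
  obtain ⟨⟨D', hD'⟩, h0', hj'⟩ := h'
  have hne : ∀ {E : ℕ} {p : MvPolynomial (Fin (n + 1)) ℂ}, p.IsHomogeneous E → p ≠ 0 →
      dehom n p ≠ 0 := fun hp hp0 h =>
    hp0 (dehom_injOn hp (isHomogeneous_zero _ _ _) (by rw [h, map_zero]))
  refine dehom_injOn ((hD _).mul (hD' _)) (add_comm D' D ▸ (hD' _).mul (hD _)) ?_
  have := (hj j).symm.trans (hj' j)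
  rw [div_eq_div_iff (hne (hD 0) h0) (hne (hD' 0) h0')] at this
  rw [map_mul, map_mul, this]

/-- The matrix `M_f` can be computed from any polynomials that represent `f` in the required
shape. -/
theorem rho_eq {n : ℕ} (f : G n) {F : Fin (n + 1) → MvPolynomial (Fin (n + 1)) ℂ}
    {I : Fin (n + 1) → Fin n →₀ ℕ} (h : IsMonomialAtInfinity f.1 F I) : rho f = expMatrix I := by
  obtain ⟨hR', d', h0', hj'⟩ := f.2.1.choose_spec.choose_spec
  obtain ⟨hR, d, h0, hj⟩ := h
  ext i j
  have e1 := (hj j).mul h0'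
  rw [hR.cross hR' j] at e1
  have e2 := DFunLike.congr_fun (e1.unique ((hj' j).mul h0)) i
  simp only [Finsupp.add_apply] at e2
  simp only [rho, expMatrix, Matrix.of_apply]
  omega

end CremonaGrp

end

open MvPolynomial

noncomputable section

namespace CremonaGrp

/-! For $S$ one takes all elements of $\ker\rho$ that restrict to some element of `SAut (n - 1)`.
Then the inclusion in the kernel and the clause on typical forms are immediate. $S$ is a group
because leading terms in $X_0$ compose well (`LeadsWith.aeval`, `mem_kerRho_iff`) and restrictions
compose, invert and are unique (`RestrictsTo.mul`, `RestrictsTo.inv`, `RestrictsTo.unique`).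

The content is surjectivity. Put $x_1 = X_1/X_0$, $z_j = X_j/X_1$ and $t = X_1/(X_0+X_1)$, so $t =
1$ on $X_0 = 0$ and $t \to 0$ as $X_0 \to \infty$. Given integer weights $w$, let $f$ fix $x_1$ and
send $z_j$ to $t^{-w_j}\psi_j(t^{w_2}z_2,\dots,t^{w_n}z_n)$. This is birational, its inverse being
built in the same way from $\psi^{-1}$ (`exists_cremona_scaledComp`). On $X_0 = 0$ it is $\psi$. If
every monomial of $\psi_j$ other than $c_jz_j$ has weight greater than $w_j$, it carries a positive
power of $t$, so only $c_jz_j$ contributes to the leading term in $X_0$. With the same condition on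
$\psi^{-1}$, this puts $f$ in the kernel (`tangent_and_restrictsTo_of_scaledComp`).

Every $\varphi$ with Jacobian determinant $1$ is a translation, after a linear map, after an
automorphism tangent to the identity at the origin (`exists_translation_mul_linAut_mul`). Weights
exist for translations (all $-1$), diagonal matrices (all $0$), transvections ($1$ at one index, $0$
elsewhere) and the tangent part (all $1$). Diagonal matrices and transvections generate the linear
part, and lifts multiply. -/

/-! ### Composition of maps given by homogeneous polynomials. -/

theorem aeval_mul_of_isHomogeneous {σ A : Type*} [CommRing A] [Algebra ℂ A]
    {p : MvPolynomial σ ℂ} {D : ℕ} (hp : p.IsHomogeneous D) (c : A) (v : σ → A) :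
    aeval (fun i => c * v i) p = c ^ D * aeval v p := by
  rw [aeval_def, aeval_def, eval₂_eq, eval₂_eq, Finset.mul_sum]
  refine Finset.sum_congr rfl fun m hm => ?_
  have hD : m.sum (fun _ k => k) = D := by
    have := hp.degree_eq_sum_deg_support hm
    rw [this]; rfl
  simp only [mul_pow, Finset.prod_mul_distrib, Finset.prod_pow_eq_pow_sum]
  rw [← hD, Finsupp.sum]
  ring

theorem dehom_ne_zero {n D : ℕ} {p : MvPolynomial (Fin (n + 1)) ℂ} (hp : p.IsHomogeneous D)
    (h0 : p ≠ 0) : dehom n p ≠ 0 := fun h =>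
  h0 (dehom_injOn hp (isHomogeneous_zero _ _ _) (by rw [h, map_zero]))

@[simp] theorem dehom_X_zero {n : ℕ} : dehom n (X 0) = 1 := by simp [dehom]

@[simp] theorem dehom_X_succ {n : ℕ} (j : Fin n) : dehom n (X j.succ) = coordFun j := by
  simp [dehom]

theorem pullback_mul {n : ℕ} (f g : Cremona n) (x : RatFun n) :
    pullback (f * g) x = pullback g (pullback f x) := rfl

/-- After dehomogenization $F_i$ is $F_0$ times the pullback of the $i$-th coordinate, and
homogeneity of `p` extracts the common factor $F_0$. -/
theorem dehom_aeval {n D : ℕ} {g : Cremona n} {F : Fin (n + 1) → MvPolynomial (Fin (n + 1)) ℂ}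
    (hF : Represents g F) {p : MvPolynomial (Fin (n + 1)) ℂ} (hp : p.IsHomogeneous D) :
    dehom n (aeval F p) = dehom n (F 0) ^ D * pullback g (dehom n p) := by
  obtain ⟨⟨E, hE⟩, h0, hj⟩ := hF
  have h0' := dehom_ne_zero (hE 0) h0
  have e1 : dehom n (aeval F p) = aeval (fun i => dehom n (F i)) p := by
    rw [← AlgHom.comp_apply, comp_aeval]
  have e2 : pullback g (dehom n p)
      = aeval (fun i => pullback g ((Fin.cons 1 coordFun : Fin (n + 1) → RatFun n) i)) p := by
    rw [dehom, ← AlgEquiv.coe_toAlgHom (pullback g), ← AlgHom.comp_apply, comp_aeval]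
  rw [e1, e2, ← aeval_mul_of_isHomogeneous hp]
  congr 2
  funext i
  refine Fin.cases ?_ (fun j => ?_) i
  · simp
  · rw [Fin.cons_succ, hj, mul_div_cancel₀ _ h0']

theorem Represents.mul {n : ℕ} {f g : Cremona n}
    {F H : Fin (n + 1) → MvPolynomial (Fin (n + 1)) ℂ}
    (hf : Represents f F) (hg : Represents g H) :
    Represents (f * g) fun i => aeval H (F i) := by
  obtain ⟨⟨D, hD⟩, h0, hj⟩ := hf
  obtain ⟨⟨E, hE⟩, h0', hj'⟩ := id hg
  have key := fun i => dehom_aeval hg (hD i)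
  have hne : pullback g (dehom n (F 0)) ≠ 0 :=
    (map_ne_zero_iff _ (pullback g).injective).2 (dehom_ne_zero (hD 0) h0)
  have hne' := pow_ne_zero D (dehom_ne_zero (hE 0) h0')
  refine ⟨⟨E * D, fun i => (hD i).aeval _ hE⟩, fun h => ?_, fun j => ?_⟩
  · have := key 0
    rw [show aeval H (F 0) = 0 from h, map_zero] at this
    exact mul_ne_zero hne' hne this.symm
  · rw [pullback_mul, hj, map_div₀, key, key, mul_div_mul_left _ _ hne']

theorem represents_one (n : ℕ) : Represents (1 : Cremona n) X := by
  refine ⟨⟨1, fun i => isHomogeneous_X _ _⟩, X_ne_zero 0, fun j => ?_⟩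
  simp only [dehom_X_succ, dehom_X_zero, div_one]
  rfl

/-! ### Leading terms in $X_0$ under products and substitution. -/

theorem LeadsWith.add_of_degree_lt {n e : ℕ} {p q : MvPolynomial (Fin (n + 1)) ℂ} {I : Fin n →₀ ℕ}
    (hp : LeadsWith p e I) (hq : (finSuccEquiv ℂ n q).degree < e) : LeadsWith (p + q) e I := by
  obtain ⟨h1, a, ha, h2⟩ := hp
  have hp0 : finSuccEquiv ℂ n p ≠ 0 := fun h => by
    rw [h, Polynomial.leadingCoeff_zero] at h2
    exact ha (monomial_eq_zero.mp h2.symm)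
  have hlt : (finSuccEquiv ℂ n q).degree < (finSuccEquiv ℂ n p).degree := by
    rwa [Polynomial.degree_eq_natDegree hp0, h1]
  refine ⟨?_, a, ha, ?_⟩
  · rw [map_add, Polynomial.natDegree_add_eq_left_of_degree_lt hlt, h1]
  · rw [map_add, Polynomial.leadingCoeff_add_of_degree_lt' hlt, h2]

theorem LeadsWith.ne_zero {n e : ℕ} {p : MvPolynomial (Fin (n + 1)) ℂ} {I : Fin n →₀ ℕ}
    (hp : LeadsWith p e I) : p ≠ 0 := by
  rintro rfl
  obtain ⟨-, a, ha, h2⟩ := hp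
  rw [map_zero, Polynomial.leadingCoeff_zero] at h2
  exact ha (monomial_eq_zero.mp h2.symm)

theorem LeadsWith.degree_eq {n e : ℕ} {p : MvPolynomial (Fin (n + 1)) ℂ} {I : Fin n →₀ ℕ}
    (hp : LeadsWith p e I) : (finSuccEquiv ℂ n p).degree = e := by
  rw [Polynomial.degree_eq_natDegree, hp.1]
  simpa using hp.ne_zero

theorem leadsWith_C {n : ℕ} {c : ℂ} (hc : c ≠ 0) :
    LeadsWith (C c : MvPolynomial (Fin (n + 1)) ℂ) 0 0 := by
  have : finSuccEquiv ℂ n (C c) = Polynomial.C (C c) := by simp [finSuccEquiv_apply]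
  refine ⟨by rw [this, Polynomial.natDegree_C], c, hc, ?_⟩
  rw [this, Polynomial.leadingCoeff_C]; rfl

theorem LeadsWith.C_mul {n e : ℕ} {p : MvPolynomial (Fin (n + 1)) ℂ} {I : Fin n →₀ ℕ}
    (hp : LeadsWith p e I) {c : ℂ} (hc : c ≠ 0) : LeadsWith (C c * p) e I := by
  simpa using (leadsWith_C hc).mul hp

theorem leadsWith_X_zero {n : ℕ} : LeadsWith (X 0 : MvPolynomial (Fin (n + 1)) ℂ) 1 0 :=
  ⟨by rw [finSuccEquiv_X_zero, Polynomial.natDegree_X], 1, one_ne_zero, by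
    rw [finSuccEquiv_X_zero, Polynomial.leadingCoeff_X]; rfl⟩

theorem leadsWith_X_succ {n : ℕ} (j : Fin n) :
    LeadsWith (X j.succ : MvPolynomial (Fin (n + 1)) ℂ) 0 (Finsupp.single j 1) :=
  ⟨by rw [finSuccEquiv_X_succ, Polynomial.natDegree_C], 1, one_ne_zero, by
    rw [finSuccEquiv_X_succ, Polynomial.leadingCoeff_C]; rfl⟩

theorem LeadsWith.pow {n e : ℕ} {p : MvPolynomial (Fin (n + 1)) ℂ} {I : Fin n →₀ ℕ}
    (hp : LeadsWith p e I) (k : ℕ) : LeadsWith (p ^ k) (k * e) (k • I) := by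
  induction k with
  | zero => simpa using leadsWith_C (n := n) one_ne_zero
  | succ k ih =>
    rw [pow_succ, Nat.succ_mul, succ_nsmul]
    exact ih.mul hp

theorem leadsWith_prod {ι : Type*} {n : ℕ} (s : Finset ι) {p : ι → MvPolynomial (Fin (n + 1)) ℂ}
    {e : ι → ℕ} {I : ι → Fin n →₀ ℕ} (h : ∀ i ∈ s, LeadsWith (p i) (e i) (I i)) :
    LeadsWith (∏ i ∈ s, p i) (∑ i ∈ s, e i) (∑ i ∈ s, I i) := by
  classical
  induction s using Finset.induction_on with
  | empty => simpa using leadsWith_C (n := n) one_ne_zero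
  | insert i s hi ih =>
    rw [Finset.prod_insert hi, Finset.sum_insert hi, Finset.sum_insert hi]
    exact (h i (Finset.mem_insert_self i s)).mul
      (ih fun k hk => h k (Finset.mem_insert_of_mem hk))

/-- All monomials but the leading one have lower degree in `X_0`. -/
theorem LeadsWith.apply_zero_lt {n e : ℕ} {p : MvPolynomial (Fin (n + 1)) ℂ} {I : Fin n →₀ ℕ}
    (hp : LeadsWith p e I) {m : Fin (n + 1) →₀ ℕ} (hm : m ∈ p.support)
    (hne : m ≠ Finsupp.cons e I) : m 0 < e := by
  obtain ⟨h1, a, ha, h2⟩ := hp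
  have hle : m 0 ≤ e := by
    rw [← h1, natDegree_finSuccEquiv]
    exact monomial_le_degreeOf 0 hm
  refine lt_of_le_of_ne hle fun h => ?_
  have h3 : coeff (Finsupp.tail m) ((finSuccEquiv ℂ n p).coeff e) = coeff m p := by
    rw [finSuccEquiv_coeff_coeff, ← h, Finsupp.cons_tail]
  rw [← h1, Polynomial.coeff_natDegree, h2, coeff_monomial, if_neg] at h3
  · exact (mem_support_iff.1 hm) h3.symm
  · rintro rfl
    exact hne (by rw [← h, Finsupp.cons_tail])

theorem LeadsWith.coeff_ne_zero {n e : ℕ} {p : MvPolynomial (Fin (n + 1)) ℂ} {I : Fin n →₀ ℕ}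
    (hp : LeadsWith p e I) : coeff (Finsupp.cons e I) p ≠ 0 := by
  obtain ⟨h1, a, ha, h2⟩ := hp
  rw [← finSuccEquiv_coeff_coeff, ← h1, Polynomial.coeff_natDegree, h2, coeff_monomial, if_pos rfl]
  exact ha

/-- Substitution turns a monomial $X^m$ of degree $D$ into a product with $X_0$-degree $Dd + m_0$.
Thus the order of monomials by $X_0$-degree is kept, and no cancellation can reach the image of the
leading one. -/
theorem LeadsWith.aeval {n e d D : ℕ} {p : MvPolynomial (Fin (n + 1)) ℂ} {I : Fin n →₀ ℕ}
    (hp : LeadsWith p e I) (hD : p.IsHomogeneous D)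
    {F : Fin (n + 1) → MvPolynomial (Fin (n + 1)) ℂ} {J : Fin n →₀ ℕ}
    (h0 : LeadsWith (F 0) (d + 1) J)
    (hj : ∀ j : Fin n, LeadsWith (F j.succ) d (J + Finsupp.single j 1)) :
    LeadsWith (aeval F p) (D * d + e) (D • J + I) := by
  have hmon : ∀ m ∈ p.support, LeadsWith (C (coeff m p) * ∏ i, F i ^ m i)
      (D * d + m 0) (D • J + m.tail) := by
    intro m hm
    have hdeg : m 0 + ∑ j : Fin n, m j.succ = D := by
      rw [← Fin.sum_univ_succ, ← Finsupp.degree_eq_sum, Finsupp.degree_eq_weight_one (R := ℕ)]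
      exact hD (mem_support_iff.1 hm)
    refine LeadsWith.C_mul ?_ (mem_support_iff.1 hm)
    have h := (h0.pow (m 0)).mul
      (leadsWith_prod Finset.univ fun j _ => (hj j).pow (m (Fin.succ j)))
    rw [← Fin.prod_univ_succ (fun i => F i ^ m i)] at h
    convert h using 1
    · rw [← hdeg, ← Finset.sum_mul]; ring
    · simp only [smul_add, Finset.sum_add_distrib, ← Finset.sum_smul]
      rw [← add_assoc, ← add_smul, hdeg]
      congr 1
      ext k
      simp [Finsupp.finsetSum_apply, Finsupp.single_apply, Finsupp.tail_apply]
  have hmem : Finsupp.cons e I ∈ p.support := mem_support_iff.2 hp.coeff_ne_zero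
  rw [aeval_def, eval₂_eq', ← Finset.add_sum_erase _ _ hmem]
  refine LeadsWith.add_of_degree_lt (by simpa using hmon _ hmem) ?_
  rw [map_sum]
  refine (Polynomial.degree_sum_le _ _).trans_lt ?_
  rw [Finset.sup_lt_iff (WithBot.bot_lt_coe _)]
  intro m hm
  have hm' := Finset.mem_of_mem_erase hm
  have h := (hmon m hm').degree_eq
  rw [MvPolynomial.algebraMap_eq, h]
  have := hp.apply_zero_lt hm' (Finset.ne_of_mem_erase hm)
  exact_mod_cast Nat.add_lt_add_left this _

/-- Only the inner map `g` has to be tangent. The shift `D • J 0` is common to all components, so it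
drops out of the exponent matrix. -/
theorem isMonomialAtInfinity_mul {n : ℕ} {f g : Cremona n}
    {F H : Fin (n + 1) → MvPolynomial (Fin (n + 1)) ℂ} {I J : Fin (n + 1) → Fin n →₀ ℕ}
    (hf : IsMonomialAtInfinity f F I) (hg : IsMonomialAtInfinity g H J)
    (hJ : ∀ j : Fin n, J j.succ = J 0 + Finsupp.single j 1) :
    ∃ D : ℕ, IsMonomialAtInfinity (f * g) (fun i => aeval H (F i)) fun i => D • J 0 + I i := by
  obtain ⟨hF, e, hF0, hFj⟩ := hf
  obtain ⟨hH, d, hH0, hHj⟩ := hg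
  simp only [hJ] at hHj
  obtain ⟨D, hD⟩ := hF.1
  exact ⟨D, hF.mul hH, D * d + e, hF0.aeval (hD 0) hH0 hHj,
    fun j => (hFj j).aeval (hD j.succ) hH0 hHj⟩

/-! ### The kernel of $\rho$ is a group. -/

/-- Half of the condition that defines the kernel of `ρ`. -/
def IsTangentAtInfinity {n : ℕ} (f : Cremona n) : Prop :=
  ∃ F I, IsMonomialAtInfinity f F I ∧ ∀ j : Fin n, I j.succ = I 0 + Finsupp.single j 1

theorem IsTangentAtInfinity.mul {n : ℕ} {f g : Cremona n} (hf : IsTangentAtInfinity f)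
    (hg : IsTangentAtInfinity g) : IsTangentAtInfinity (f * g) := by
  obtain ⟨F, I, hF, hI⟩ := hf
  obtain ⟨H, J, hH, hJ⟩ := hg
  obtain ⟨D, h⟩ := isMonomialAtInfinity_mul hF hH hJ
  exact ⟨_, _, h, fun j => by rw [hI, add_assoc]⟩

theorem expMatrix_eq_one_iff {n : ℕ} (I : Fin (n + 1) → Fin n →₀ ℕ) :
    expMatrix I = 1 ↔ ∀ j : Fin n, I j.succ = I 0 + Finsupp.single j 1 := by
  constructor
  · intro h j
    ext i
    have := congrFun (congrFun h i) j
    simp only [expMatrix, Matrix.of_apply, Matrix.one_apply] at this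
    simp only [Finsupp.add_apply, Finsupp.single_apply]
    by_cases hij : i = j
    · simp only [hij, if_true] at this ⊢; omega
    · simp only [hij, if_false, Ne.symm hij] at this ⊢; omega
  · intro h
    ext i j
    simp only [expMatrix, Matrix.of_apply, Matrix.one_apply, h, Finsupp.add_apply,
      Finsupp.single_apply]
    by_cases hij : i = j
    · simp [hij]
    · simp [hij, Ne.symm hij]

theorem isMonomialAtInfinity_one (n : ℕ) :
    IsMonomialAtInfinity (1 : Cremona n) X (Fin.cons 0 fun j => Finsupp.single j 1) :=
  ⟨represents_one n, 0, by simpa using leadsWith_X_zero, fun j => by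
    simpa using leadsWith_X_succ j⟩

theorem isTangentAtInfinity_one (n : ℕ) : IsTangentAtInfinity (1 : Cremona n) :=
  ⟨_, _, isMonomialAtInfinity_one n, fun j => by simp⟩

/-- This makes membership symmetric in `f` and `f⁻¹`, although the kernel prescribes the exponent
matrix of `f` alone. -/
theorem mem_kerRho_iff {n : ℕ} (f : Cremona n) :
    f ∈ kerRho n ↔ IsTangentAtInfinity f ∧ IsTangentAtInfinity f⁻¹ := by
  constructor
  · rintro ⟨hG, h⟩
    obtain ⟨⟨F, I, hF⟩, H, J, hH⟩ := id hG
    rw [rho_eq _ hF, expMatrix_eq_one_iff] at h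
    refine ⟨⟨F, I, hF, h⟩, H, J, hH, ?_⟩
    -- The exponents of `f⁻¹ * f` are those of `f⁻¹` up to a common shift. Since this product is the
    -- identity, `rho_eq` forces their matrix to be $1$.
    obtain ⟨D, h'⟩ := isMonomialAtInfinity_mul hH hF h
    rw [inv_mul_cancel] at h'
    have h1 : (1 : Cremona n) ∈ G n :=
      ⟨⟨_, _, isMonomialAtInfinity_one n⟩, inv_one (G := Cremona n) ▸ ⟨_, _, isMonomialAtInfinity_one n⟩⟩
    have e := (rho_eq ⟨1, h1⟩ h').symm.trans (rho_eq ⟨1, h1⟩ (isMonomialAtInfinity_one n))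
    rw [(expMatrix_eq_one_iff (Fin.cons 0 fun j => Finsupp.single j 1)).2 (fun j => by simp),
      expMatrix_eq_one_iff] at e
    intro j
    have := e j
    rwa [add_assoc, add_right_inj] at this
  · rintro ⟨⟨F, I, hF, hI⟩, H, J, hH, -⟩
    exact ⟨⟨⟨F, I, hF⟩, H, J, hH⟩, by rwa [rho_eq _ hF, expMatrix_eq_one_iff]⟩

/-- The kernel of `ρ` as a subgroup. -/
def kerRhoSubgroup (n : ℕ) : Subgroup (Cremona n) where
  carrier := kerRho n
  one_mem' := by
    rw [mem_kerRho_iff, inv_one]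
    exact ⟨isTangentAtInfinity_one n, isTangentAtInfinity_one n⟩
  mul_mem' := by
    intro f g hf hg
    rw [mem_kerRho_iff] at *
    rw [mul_inv_rev]
    exact ⟨hf.1.mul hg.1, hg.2.mul hf.2⟩
  inv_mem' := by
    intro f hf
    rw [mem_kerRho_iff] at *
    rw [inv_inv]
    exact hf.symm

/-! ### Restriction to the hyperplane $X_0 = 0$. -/

/-- The index of the affine coordinate `X_{j+2} / X_0`. -/
def affIdx {n : ℕ} (j : Fin (n - 1)) : Fin n := ⟨j.1 + 1, by omega⟩

theorem idx_eq_succ {n : ℕ} (j : Fin (n - 1)) : idx j = (affIdx j).succ := rfl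

theorem one_eq_succ {n : ℕ} [NeZero n] : (1 : Fin (n + 1)) = Fin.succ 0 :=
  Fin.succ_zero_eq_one'.symm

theorem eq_zero_or_one_or_idx {n : ℕ} [NeZero n] (i : Fin (n + 1)) :
    i = 0 ∨ i = 1 ∨ ∃ j : Fin (n - 1), i = idx j := by
  rcases Nat.lt_or_ge i.1 2 with h | h
  · have : i.1 = 0 ∨ i.1 = 1 := by omega
    rcases this with h | h
    · exact Or.inl (Fin.ext h)
    · refine Or.inr (Or.inl (Fin.ext ?_))
      rw [h, one_eq_succ]; rfl
  · refine Or.inr (Or.inr ⟨⟨i.1 - 2, by omega⟩, Fin.ext ?_⟩)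
    simp only [idx]; omega

theorem eq_zero_or_affIdx {n : ℕ} [NeZero n] (i : Fin n) :
    i = 0 ∨ ∃ j : Fin (n - 1), i = affIdx j := by
  rcases Nat.eq_zero_or_pos i.1 with h | h
  · exact Or.inl (Fin.ext h)
  · refine Or.inr ⟨⟨i.1 - 1, by omega⟩, Fin.ext ?_⟩
    simp only [affIdx]; omega

@[simp] theorem restrict_X_zero {n : ℕ} : restrict n (X 0) = 0 := by simp [restrict]

@[simp] theorem restrict_X_one {n : ℕ} [NeZero n] : restrict n (X 1) = 1 := by
  have h1 : ((1 : Fin (n + 1)) : ℕ) = 1 := by rw [one_eq_succ]; rfl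
  simp only [restrict, aeval_X, h1]
  simp

@[simp] theorem restrict_X_idx {n : ℕ} (j : Fin (n - 1)) : restrict n (X (idx j)) = X j := by
  simp [restrict, idx]

theorem restrict_C {n : ℕ} (c : ℂ) : restrict n (C c) = C c := by
  simp [restrict]

theorem PolyAut.ext {m : ℕ} {φ ψ : PolyAut m} (h : ∀ j, comp φ j = comp ψ j) : φ = ψ := by
  apply MulOpposite.unop_injective
  have : (φ.unop : MvPolynomial (Fin m) ℂ →ₐ[ℂ] MvPolynomial (Fin m) ℂ) = ψ.unop :=
    MvPolynomial.algHom_ext h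
  exact AlgEquiv.ext fun x => DFunLike.congr_fun this x

theorem comp_mul {m : ℕ} (φ ψ : PolyAut m) (j : Fin m) :
    comp (φ * ψ) j = ψ.unop (comp φ j) := rfl

theorem Represents.cross' {n : ℕ} {f : Cremona n}
    {F F' : Fin (n + 1) → MvPolynomial (Fin (n + 1)) ℂ}
    (h : Represents f F) (h' : Represents f F') (i k : Fin (n + 1)) :
    F i * F' k = F' i * F k := by
  have key : ∀ i, F i * F' 0 = F' i * F 0 := fun i => by
    refine Fin.cases (mul_comm _ _) (fun j => h.cross h' j) i
  have h0 := h.2.1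
  have h0' := h'.2.1
  apply mul_right_cancel₀ h0
  apply mul_right_cancel₀ h0'
  linear_combination (F' k * F 0) * key i - (F' i * F 0) * key k

/-- Representations of `f` are proportional, so the ratios $F_j/F_1$ on the hyperplane are
determined by `f`. -/
theorem RestrictsTo.unique {n : ℕ} {f : Cremona n} {φ ψ : PolyAut (n - 1)}
    (h : RestrictsTo f φ) (h' : RestrictsTo f ψ) : φ = ψ := by
  obtain ⟨F, hF, -, h1, hj⟩ := h
  obtain ⟨F', hF', -, h1', hj'⟩ := h'
  refine PolyAut.ext fun j => ?_
  have := congrArg (restrict n) (hF.cross' hF' (idx j) 1)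
  rw [map_mul, map_mul, hj, hj'] at this
  apply mul_right_cancel₀ h1
  apply mul_right_cancel₀ h1'
  linear_combination this

/-- On the hyperplane $F = F_1\cdot(0, 1, \varphi)$, and homogeneity of `p` extracts the factor
$F_1$. -/
theorem restrict_aeval {n D : ℕ} [NeZero n] {φ : PolyAut (n - 1)}
    {F : Fin (n + 1) → MvPolynomial (Fin (n + 1)) ℂ} (h0 : restrict n (F 0) = 0)
    (hj : ∀ j : Fin (n - 1), restrict n (F (idx j)) = comp φ j * restrict n (F 1))
    {p : MvPolynomial (Fin (n + 1)) ℂ} (hp : p.IsHomogeneous D) :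
    restrict n (aeval F p) = restrict n (F 1) ^ D * φ.unop (restrict n p) := by
  have e1 : restrict n (aeval F p) = aeval (fun i => restrict n (F i)) p := by
    rw [← AlgHom.comp_apply, comp_aeval]
  have e2 : φ.unop (restrict n p) = aeval (fun i => φ.unop (restrict n (X i))) p := by
    have : (φ.unop : MvPolynomial (Fin (n - 1)) ℂ →ₐ[ℂ] _).comp (restrict n)
        = aeval (fun i => φ.unop (restrict n (X i))) :=
      MvPolynomial.algHom_ext fun i => by simp
    exact DFunLike.congr_fun this p
  rw [e1, e2, ← aeval_mul_of_isHomogeneous hp]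
  congr 2
  funext i
  obtain rfl | rfl | ⟨j, rfl⟩ := eq_zero_or_one_or_idx i
  · simp [h0]
  · simp
  · rw [hj, restrict_X_idx, mul_comm]; rfl

theorem RestrictsTo.mul {n : ℕ} [NeZero n] {f g : Cremona n} {φ ψ : PolyAut (n - 1)}
    (hf : RestrictsTo f φ) (hg : RestrictsTo g ψ) : RestrictsTo (f * g) (φ * ψ) := by
  obtain ⟨F, hF, h0, h1, hj⟩ := hf
  obtain ⟨H, hH, h0', h1', hj'⟩ := hg
  obtain ⟨D, hD⟩ := hF.1
  have key := fun i => restrict_aeval h0' hj' (hD i)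
  refine ⟨_, hF.mul hH, ?_, ?_, fun j => ?_⟩
  · change restrict n (aeval H (F 0)) = 0
    rw [key, h0, map_zero, mul_zero]
  · change restrict n (aeval H (F 1)) ≠ 0
    rw [key]
    exact mul_ne_zero (pow_ne_zero _ h1') ((map_ne_zero_iff _ ψ.unop.injective).2 h1)
  · change restrict n (aeval H (F (idx j))) = _ * restrict n (aeval H (F 1))
    rw [key, key, hj, map_mul, comp_mul]
    ring

theorem restrictsTo_one (n : ℕ) [NeZero n] : RestrictsTo (1 : Cremona n) 1 :=
  ⟨X, represents_one n, by simp, by simp, fun j => by simp [comp]⟩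

/-- Restriction factors as $X_0 = 0$, the constant coefficient in $X_0$, followed by $X_1 = 1$, a
dehomogenization in one variable fewer. Hence `dehom_ne_zero` becomes available for restrictions. -/
theorem algebraMap_restrict (m : ℕ) (p : MvPolynomial (Fin (m + 2)) ℂ) :
    algebraMap (MvPolynomial (Fin m) ℂ) (RatFun m) (restrict (m + 1) p) =
      dehom m ((finSuccEquiv ℂ (m + 1) p).coeff 0) := by
  induction p using MvPolynomial.induction_on with
  | C a =>
    rw [restrict_C]
    have h1 : dehom m (C a) = algebraMap ℂ (RatFun m) a := (dehom m).commutes a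
    have h2 : finSuccEquiv ℂ (m + 1) (C a) = Polynomial.C (C a) := by simp [finSuccEquiv_apply]
    rw [h2, Polynomial.coeff_C_zero, h1]
    exact (IsScalarTower.algebraMap_apply ℂ (MvPolynomial (Fin m) ℂ) (RatFun m) a).symm
  | add p q hp hq => simp [hp, hq]
  | mul_X p i hp =>
    rw [map_mul, map_mul, hp, map_mul, Polynomial.mul_coeff_zero, map_mul]
    congr 1
    refine Fin.cases ?_ (fun i => Fin.cases ?_ (fun j => ?_) i) i
    · rw [restrict_X_zero, finSuccEquiv_X_zero]; simp
    · rw [finSuccEquiv_X_succ, Polynomial.coeff_C_zero, dehom_X_zero]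
      simp [restrict]
    · rw [finSuccEquiv_X_succ, Polynomial.coeff_C_zero, dehom_X_succ]
      exact congrArg _ (restrict_X_idx (n := m + 1) j)

theorem X_zero_dvd_of_restrict_eq_zero {n D : ℕ} [NeZero n] {p : MvPolynomial (Fin (n + 1)) ℂ}
    (hp : p.IsHomogeneous D) (h : restrict n p = 0) : X 0 ∣ p := by
  obtain ⟨m, rfl⟩ := Nat.exists_eq_succ_of_ne_zero (NeZero.ne n)
  have h1 := algebraMap_restrict m p
  have h2 : ((finSuccEquiv ℂ (m + 1) p).coeff 0).IsHomogeneous D :=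
    hp.finSuccEquiv_coeff_isHomogeneous 0 D (zero_add D)
  have h3 : (finSuccEquiv ℂ (m + 1) p).coeff 0 = 0 := by
    by_contra hne
    refine dehom_ne_zero h2 hne (h1.symm.trans ?_)
    exact (congrArg _ h).trans (map_zero _)
  have h4 := map_dvd (finSuccEquiv ℂ (m + 1)).symm (Polynomial.X_dvd_iff.2 h3)
  rwa [AlgEquiv.symm_apply_apply, ← finSuccEquiv_X_zero, AlgEquiv.symm_apply_apply] at h4

theorem isHomogeneous_of_X_mul {σ : Type*} {D : ℕ} {q : MvPolynomial σ ℂ} (i : σ)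
    (h : (X i * q).IsHomogeneous (D + 1)) : q.IsHomogeneous D := by
  intro m hm
  rw [← coeff_X_mul m i q] at hm
  have := h hm
  rw [map_add, Finsupp.weight_single] at this
  simp only [Pi.one_apply, smul_eq_mul, mul_one] at this
  omega

/-- As long as all components vanish on the hyperplane, they have the common factor $X_0$, which can
be cancelled. The degree drops each time, so this stops. -/
theorem Represents.exists_restrict_ne_zero {n : ℕ} [NeZero n] {f : Cremona n}
    {F : Fin (n + 1) → MvPolynomial (Fin (n + 1)) ℂ} (hF : Represents f F) :
    ∃ H, Represents f H ∧ ∃ i, restrict n (H i) ≠ 0 := by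
  obtain ⟨⟨D, hD⟩, h0, hj⟩ := hF
  induction D generalizing F with
  | zero =>
    refine ⟨F, ⟨⟨0, hD⟩, h0, hj⟩, 0, fun h => h0 ?_⟩
    have := totalDegree_eq_zero_iff_eq_C.1 ((totalDegree_zero_iff_isHomogeneous _).2 (hD 0))
    rw [this, restrict_C, C_eq_zero] at h
    rw [this, h, map_zero]
  | succ D ih =>
    by_cases h : ∀ i, restrict n (F i) = 0
    · choose Q hQ using fun i => X_zero_dvd_of_restrict_eq_zero (hD i) (h i)
      refine ih (F := Q) (fun i => isHomogeneous_of_X_mul 0 (hQ i ▸ hD i)) ?_ fun j => ?_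
      · rintro hQ0
        exact h0 (by rw [hQ, hQ0, mul_zero])
      · rw [hj, hQ, hQ 0, map_mul, map_mul, dehom_X_zero, one_mul, one_mul]
    · push Not at h
      exact ⟨F, ⟨⟨_, hD⟩, h0, hj⟩, h⟩

/-- A representation `H` of `f⁻¹` that is not identically zero on the hyperplane is needed.
Restricting the proportionality of $H\circ F$ and $X$ gives $H_i = \varphi^{-1}(X_i)\,H_1$ there, so
$H_1$ cannot vanish. -/
theorem RestrictsTo.inv {n : ℕ} [NeZero n] {f : Cremona n} {φ : PolyAut (n - 1)}
    (hf : RestrictsTo f φ) {H : Fin (n + 1) → MvPolynomial (Fin (n + 1)) ℂ}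
    (hH : Represents f⁻¹ H) : RestrictsTo f⁻¹ φ⁻¹ := by
  obtain ⟨H, hH, i, hi⟩ := hH.exists_restrict_ne_zero
  obtain ⟨F, hF, h0, h1, hj⟩ := hf
  obtain ⟨D, hD⟩ := hH.1
  have key := fun i => restrict_aeval h0 hj (hD i)
  have hrep := hH.mul hF
  rw [inv_mul_cancel] at hrep
  have hcross : ∀ i, φ.unop (restrict n (H i)) =
      restrict n (X i) * φ.unop (restrict n (H 1)) := fun i => by
    have := congrArg (restrict n) (hrep.cross' (represents_one n) i 1)
    rw [map_mul, map_mul, restrict_X_one, key, key, mul_one] at this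
    apply mul_left_cancel₀ (pow_ne_zero D h1)
    rw [this]
    ring
  have hcross' : ∀ i, restrict n (H i) =
      φ.unop.symm (restrict n (X i)) * restrict n (H 1) := fun i => by
    apply φ.unop.injective
    rw [hcross, map_mul, AlgEquiv.apply_symm_apply]
  refine ⟨H, hH, ?_, fun h => hi ?_, fun j => ?_⟩
  · rw [hcross', restrict_X_zero, map_zero, zero_mul]
  · rw [hcross', h, mul_zero]
  · rw [hcross', restrict_X_idx]; rfl

theorem represents_inv_of_mem_kerRho {n : ℕ} {f : Cremona n} (hf : f ∈ kerRho n) :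
    ∃ H, Represents f⁻¹ H := by
  obtain ⟨-, H, _, hH, -⟩ := (mem_kerRho_iff f).1 hf
  exact ⟨H, hH.1⟩

/-- The elements of the kernel of `ρ` that restrict to an element of `SAut` on `X_0 = 0`. -/
def restrictingSubgroup (n : ℕ) [NeZero n] : Subgroup (Cremona n) where
  carrier := {f | f ∈ kerRho n ∧ ∃ φ ∈ SAut (n - 1), RestrictsTo f φ}
  one_mem' := ⟨(kerRhoSubgroup n).one_mem, 1, one_mem _, restrictsTo_one n⟩
  mul_mem' := by
    rintro f g ⟨hf, φ, hφ, h⟩ ⟨hg, ψ, hψ, h'⟩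
    exact ⟨(kerRhoSubgroup n).mul_mem hf hg, φ * ψ, mul_mem hφ hψ, h.mul h'⟩
  inv_mem' := by
    rintro f ⟨hf, φ, hφ, h⟩
    obtain ⟨H, hH⟩ := represents_inv_of_mem_kerRho hf
    exact ⟨(kerRhoSubgroup n).inv_mem hf, φ⁻¹, inv_mem hφ, h.inv hH⟩

/-- Restriction to `X_0 = 0`. -/
def restrictHom (n : ℕ) [NeZero n] : restrictingSubgroup n →* SAut (n - 1) :=
  -- The restriction is a chosen witness; its uniqueness yields multiplicativity.
  MonoidHom.mk' (fun f => ⟨f.2.2.choose, f.2.2.choose_spec.1⟩) fun f g => Subtype.ext <|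
    (f * g).2.2.choose_spec.2.unique (f.2.2.choose_spec.2.mul g.2.2.choose_spec.2)

theorem restrictsTo_restrictHom {n : ℕ} [NeZero n] (f : restrictingSubgroup n) :
    RestrictsTo (f : Cremona n) (restrictHom n f : PolyAut (n - 1)) :=
  f.2.2.choose_spec.2

/-! ### Birational maps from generators of the function field. -/

theorem isTranscendenceBasis_coordFun (n : ℕ) :
    IsTranscendenceBasis ℂ (coordFun : Fin n → RatFun n) := by
  have : Algebra.IsAlgebraic (MvPolynomial (Fin n) ℂ) (RatFun n) :=
    IsLocalization.isAlgebraic _ (nonZeroDivisors (MvPolynomial (Fin n) ℂ))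
  exact (IsTranscendenceBasis.mvPolynomial (Fin n) ℂ).algebraMap_comp

/-- The transcendence degree is $n$, so $n$ generators are algebraically independent. The
substitution therefore extends to the fraction field, and it is onto because they generate. -/
theorem exists_cremona_of_adjoin_eq_top {n : ℕ} (a : Fin n → RatFun n)
    (h : IntermediateField.adjoin ℂ (Set.range a) = ⊤) :
    ∃ f : Cremona n, ∀ j, pullback f (coordFun j) = a j := by
  have halg : Algebra.IsAlgebraic (Algebra.adjoin ℂ (Set.range a)) (RatFun n) := by
    refine ⟨fun x => ?_⟩
    have hx : x ∈ IntermediateField.adjoin ℂ (Set.range a) := h ▸ IntermediateField.mem_top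
    obtain ⟨r, hr, s, hs, rfl⟩ := IntermediateField.mem_adjoin_iff_div.1 hx
    rw [div_eq_mul_inv]
    exact (isAlgebraic_algebraMap (⟨r, hr⟩ : Algebra.adjoin ℂ (Set.range a))).mul
      (isAlgebraic_algebraMap (⟨s, hs⟩ : Algebra.adjoin ℂ (Set.range a))).inv
  have hind : AlgebraicIndependent ℂ a :=
    (Algebra.IsAlgebraic.isTranscendenceBasis_of_le_trdeg_of_finite ℂ a
      (isTranscendenceBasis_coordFun n).cardinalMk_eq_trdeg.le).1
  let σ : RatFun n →ₐ[ℂ] RatFun n := IsFractionRing.liftAlgHom (g := aeval a) hind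
  have hσ : ∀ j, σ (coordFun j) = a j := fun j => by
    exact (IsFractionRing.lift_algebraMap hind (X j)).trans (aeval_X a j)
  have hsurj : Function.Surjective σ := by
    rw [← AlgHom.fieldRange_eq_top, eq_top_iff, ← h, IntermediateField.adjoin_le_iff]
    rintro _ ⟨j, rfl⟩
    exact ⟨coordFun j, hσ j⟩
  exact ⟨MulOpposite.op (AlgEquiv.ofBijective σ ⟨σ.toRingHom.injective, hsurj⟩), hσ⟩

/-- The function on `Fin n` with first value `a` and further values `b`. -/
def affCons {n : ℕ} {α : Type*} (a : α) (b : Fin (n - 1) → α) (i : Fin n) : α :=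
  if h : i.1 = 0 then a else b ⟨i.1 - 1, by omega⟩

@[simp] theorem affCons_zero {n : ℕ} [NeZero n] {α : Type*} (a : α) (b : Fin (n - 1) → α) :
    affCons a b 0 = a := by simp [affCons]

@[simp] theorem affCons_affIdx {n : ℕ} {α : Type*} (a : α) (b : Fin (n - 1) → α)
    (j : Fin (n - 1)) : affCons a b (affIdx j) = b j := by simp [affCons, affIdx]

/-! ### Lifting an automorphism by conjugation with powers of $t$. -/

section Scaling

variable {n : ℕ}

theorem coordFun_ne_zero (j : Fin n) : (coordFun j : RatFun n) ≠ 0 := by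
  rw [coordFun, ne_eq, map_eq_zero_iff _ (IsFractionRing.injective _ _)]
  exact X_ne_zero j

theorem one_add_coordFun_ne_zero (j : Fin n) : (1 + coordFun j : RatFun n) ≠ 0 := by
  intro h
  have h1 : algebraMap (MvPolynomial (Fin n) ℂ) (RatFun n) (1 + X j) = 0 := by
    rw [map_add, map_one]; exact h
  rw [map_eq_zero_iff _ (IsFractionRing.injective _ _)] at h1
  simpa using congrArg (eval 0) h1

variable [NeZero n]

@[simp] theorem dehom_X_one : dehom n (X 1) = coordFun 0 := by
  rw [one_eq_succ, dehom_X_succ]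

/-- The function `X_1 / (X_0 + X_1)`, which is `0` at infinity and `1` on `X_0 = 0`. -/
def interp (n : ℕ) [NeZero n] : RatFun n := coordFun 0 / (1 + coordFun 0)

/-- The affine coordinate `X_j / X_1`. -/
def affCoord (j : Fin (n - 1)) : RatFun n := coordFun (affIdx j) / coordFun 0

/-- The conjugate of `ψ_j` by the diagonal map with entries `t ^ w_j`, where `t = interp n`. -/
def scaledComp (w : Fin (n - 1) → ℤ) (ψ : PolyAut (n - 1)) (j : Fin (n - 1)) : RatFun n :=
  (interp n ^ w j)⁻¹ * aeval (fun k => interp n ^ w k * affCoord k) (comp ψ j)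

theorem interp_ne_zero : interp n ≠ 0 :=
  div_ne_zero (coordFun_ne_zero 0) (one_add_coordFun_ne_zero 0)

theorem coordFun_zero_mul_affCoord (j : Fin (n - 1)) :
    coordFun 0 * affCoord j = (coordFun (affIdx j) : RatFun n) :=
  mul_div_cancel₀ _ (coordFun_ne_zero 0)

theorem interp_zpow_mul_scaledComp (w : Fin (n - 1) → ℤ) (ψ : PolyAut (n - 1)) (j : Fin (n - 1)) :
    interp n ^ w j * scaledComp w ψ j =
      aeval (fun k => interp n ^ w k * affCoord k) (comp ψ j) :=
  mul_inv_cancel_left₀ (zpow_ne_zero _ interp_ne_zero) _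

/-- The conjugate of `ψ⁻¹` by the same diagonal map undoes the conjugate of `ψ`. -/
theorem aeval_scaledComp (w : Fin (n - 1) → ℤ) (ψ : PolyAut (n - 1)) (j : Fin (n - 1)) :
    aeval (fun k => interp n ^ w k * scaledComp w ψ k) (comp ψ⁻¹ j) =
      interp n ^ w j * affCoord j := by
  simp only [interp_zpow_mul_scaledComp]
  have : (aeval fun k => aeval (fun k => interp n ^ w k * affCoord k) (comp ψ k)) =
      (aeval fun k => interp n ^ w k * affCoord k).comp
        (ψ.unop : MvPolynomial (Fin (n - 1)) ℂ →ₐ[ℂ] MvPolynomial (Fin (n - 1)) ℂ) :=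
    MvPolynomial.algHom_ext fun i => by simp [comp]
  rw [this]
  have h2 : ψ.unop (comp ψ⁻¹ j) = X j := ψ.unop.apply_symm_apply (X j)
  change aeval _ (ψ.unop (comp ψ⁻¹ j)) = _
  rw [h2, aeval_X]

theorem exists_cremona_scaledComp (w : Fin (n - 1) → ℤ) (ψ : PolyAut (n - 1)) :
    ∃ f : Cremona n,
      (pullback f (coordFun 0) = coordFun 0 ∧
        ∀ j, pullback f (coordFun (affIdx j)) = coordFun 0 * scaledComp w ψ j) ∧
      (pullback f⁻¹ (coordFun 0) = coordFun 0 ∧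
        ∀ j, pullback f⁻¹ (coordFun (affIdx j)) = coordFun 0 * scaledComp w ψ⁻¹ j) := by
  have hgen : IntermediateField.adjoin ℂ (Set.range (affCons (coordFun 0 : RatFun n)
      fun j => coordFun 0 * scaledComp w ψ j)) = ⊤ := by
    set E := IntermediateField.adjoin ℂ (Set.range (affCons (coordFun 0 : RatFun n)
      fun j => coordFun 0 * scaledComp w ψ j)) with hE
    have h0 : coordFun 0 ∈ E :=
      IntermediateField.subset_adjoin _ _ ⟨0, affCons_zero _ _⟩
    have hb : ∀ j, scaledComp w ψ j ∈ E := fun j => by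
      have h1 : coordFun 0 * scaledComp w ψ j ∈ E :=
        IntermediateField.subset_adjoin _ _ ⟨affIdx j, affCons_affIdx _ _ _⟩
      have h2 := E.mul_mem (E.inv_mem h0) h1
      rwa [inv_mul_cancel_left₀ (coordFun_ne_zero 0)] at h2
    have ht : interp n ∈ E := E.div_mem h0 (E.add_mem E.one_mem h0)
    -- The coordinates $z_j$ are recovered through `ψ⁻¹`, since $t$ is a function of $x_1$ and so
    -- lies in `E`.
    have hz : ∀ j, affCoord j ∈ E := fun j => by
      have h1 : aeval (fun k => interp n ^ w k * scaledComp w ψ k) (comp ψ⁻¹ j) ∈ E := by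
        have : (aeval (fun k => interp n ^ w k * scaledComp w ψ k) :
            MvPolynomial (Fin (n - 1)) ℂ →ₐ[ℂ] RatFun n) (comp ψ⁻¹ j) =
            algebraMap E (RatFun n) (aeval (fun k => (⟨interp n ^ w k * scaledComp w ψ k,
              E.mul_mem (zpow_mem ht _) (hb k)⟩ : E)) (comp ψ⁻¹ j)) := by
          rw [← aeval_algebraMap_apply]; rfl
        rw [this]
        exact SetLike.coe_mem _
      rw [aeval_scaledComp] at h1
      have h2 := E.mul_mem (E.inv_mem (zpow_mem ht (w j))) h1
      rwa [inv_mul_cancel_left₀ (zpow_ne_zero _ interp_ne_zero)] at h2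
    have hx : ∀ i, coordFun i ∈ E := fun i => by
      obtain rfl | ⟨j, rfl⟩ := eq_zero_or_affIdx i
      · exact h0
      · rw [← coordFun_zero_mul_affCoord]
        exact E.mul_mem h0 (hz j)
    have hp : ∀ p : MvPolynomial (Fin n) ℂ, algebraMap _ (RatFun n) p ∈ E := fun p => by
      induction p using MvPolynomial.induction_on with
      | C a =>
        have := E.algebraMap_mem a
        rwa [IsScalarTower.algebraMap_apply ℂ (MvPolynomial (Fin n) ℂ) (RatFun n)] at this
      | add p q hp hq => rw [map_add]; exact E.add_mem hp hq
      | mul_X p i hp => rw [map_mul]; exact E.mul_mem hp (hx i)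
    rw [eq_top_iff]
    intro x _
    obtain ⟨p, q, -, rfl⟩ := IsFractionRing.div_surjective (A := MvPolynomial (Fin n) ℂ) x
    exact E.div_mem (hp p) (hp q)
  obtain ⟨f, hf⟩ := exists_cremona_of_adjoin_eq_top _ hgen
  have hf0 : pullback f (coordFun 0) = coordFun 0 := by simpa using hf 0
  have hfj : ∀ j, pullback f (coordFun (affIdx j)) = coordFun 0 * scaledComp w ψ j :=
    fun j => by simpa using hf (affIdx j)
  refine ⟨f, ⟨hf0, hfj⟩, (pullback f).symm_apply_eq.2 hf0.symm,
    fun j => (pullback f).symm_apply_eq.2 ?_⟩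
  -- As $t$ is invariant under `f`, the diagonal conjugation commutes with the pullback.
  have ht : pullback f (interp n) = interp n := by simp [interp, hf0]
  have hz : ∀ j, pullback f (affCoord j) = scaledComp w ψ j := fun j => by
    rw [affCoord, map_div₀, hf0, hfj, mul_div_cancel_left₀ _ (coordFun_ne_zero 0)]
  have hev : pullback f (aeval (fun k => interp n ^ w k * affCoord k) (comp ψ⁻¹ j)) =
      aeval (fun k => interp n ^ w k * scaledComp w ψ k) (comp ψ⁻¹ j) := by
    have : ((pullback f : RatFun n ≃ₐ[ℂ] RatFun n) : RatFun n →ₐ[ℂ] RatFun n).comp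
        (aeval fun k => interp n ^ w k * affCoord k) =
        aeval fun k => interp n ^ w k * scaledComp w ψ k :=
      MvPolynomial.algHom_ext fun i => by simp [ht, hz]
    exact DFunLike.congr_fun this _
  rw [map_mul, hf0, scaledComp, map_mul, map_inv₀, map_zpow₀, ht, hev, aeval_scaledComp,
    inv_mul_cancel_left₀ (zpow_ne_zero _ interp_ne_zero), coordFun_zero_mul_affCoord]

/-! ### Weights and the order of vanishing at $X_0 = \infty$. -/

/-- `ψ_j = c_j x_j + (monomials of weight larger than w_j)` with `c_j ≠ 0`. -/
def IsDiagonalInLowestWeight {m : ℕ} (w : Fin m → ℤ) (ψ : PolyAut m) : Prop :=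
  ∀ j, ∃ c : ℂ, c ≠ 0 ∧ ∀ μ ∈ (comp ψ j - C c * X j).support, w j < ∑ k, μ k * w k

/-- `u`, a rational function that vanishes at infinity, has numerators with denominator
`X_1 ^ M * (X_0 + X_1) ^ N` for large `M` and `N`, with restriction `p` to `X_0 = 0`. -/
def HasNumerators (u : RatFun n) (p : MvPolynomial (Fin (n - 1)) ℂ) : Prop :=
  ∃ A : ℕ, ∀ M N : ℕ, A ≤ M → A ≤ N → ∃ F : MvPolynomial (Fin (n + 1)) ℂ,
    F.IsHomogeneous (M + N + 1) ∧
      dehom n F = coordFun 0 ^ (M + 1) * (1 + coordFun 0) ^ N * u ∧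
      (finSuccEquiv ℂ n F).degree < N ∧ restrict n F = p

theorem hasNumerators_zero : HasNumerators (0 : RatFun n) 0 :=
  ⟨0, fun M N _ _ => ⟨0, isHomogeneous_zero _ _ _, by simp, by simp, by simp⟩⟩

theorem HasNumerators.add {u v : RatFun n} {p q : MvPolynomial (Fin (n - 1)) ℂ}
    (hu : HasNumerators u p) (hv : HasNumerators v q) : HasNumerators (u + v) (p + q) := by
  obtain ⟨A, hA⟩ := hu
  obtain ⟨B, hB⟩ := hv
  refine ⟨max A B, fun M N hM hN => ?_⟩
  obtain ⟨F, h1, h2, h3, h4⟩ := hA M N (le_of_max_le_left hM) (le_of_max_le_left hN)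
  obtain ⟨H, h1', h2', h3', h4'⟩ := hB M N (le_of_max_le_right hM) (le_of_max_le_right hN)
  refine ⟨F + H, h1.add h1', by rw [map_add, h2, h2', mul_add], ?_, by rw [map_add, h4, h4']⟩
  rw [map_add]
  exact (Polynomial.degree_add_le _ _).trans_lt (max_lt h3 h3')

theorem hasNumerators_sum {ι : Type*} (s : Finset ι) {u : ι → RatFun n}
    {p : ι → MvPolynomial (Fin (n - 1)) ℂ} (h : ∀ i ∈ s, HasNumerators (u i) (p i)) :
    HasNumerators (∑ i ∈ s, u i) (∑ i ∈ s, p i) := by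
  classical
  induction s using Finset.induction_on with
  | empty => exact hasNumerators_zero
  | insert i s hi ih =>
    rw [Finset.sum_insert hi, Finset.sum_insert hi]
    exact (h i (Finset.mem_insert_self i s)).add
      (ih fun k hk => h k (Finset.mem_insert_of_mem hk))

theorem leadsWith_X_zero_add_X_one :
    LeadsWith (X 0 + X 1 : MvPolynomial (Fin (n + 1)) ℂ) 1 0 := by
  refine leadsWith_X_zero.add_of_degree_lt ?_
  rw [one_eq_succ, (leadsWith_X_succ _).degree_eq]
  exact_mod_cast zero_lt_one

/-- The numerator is $c\,X_1^{M+1+k-|\mu|}(X_0+X_1)^{N-k}\prod_i X_i^{\mu_i}$. A positive power of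
$t$ makes its $X_0$-degree $N-k$ smaller than $N$. -/
theorem hasNumerators_monomial {k : ℕ} (hk : 0 < k) {c : ℂ} (hc : c ≠ 0) (μ : Fin (n - 1) →₀ ℕ) :
    HasNumerators (algebraMap ℂ (RatFun n) c * (interp n ^ k * ∏ i, affCoord i ^ μ i))
      (monomial μ c) := by
  refine ⟨k + ∑ i, μ i, fun M N hM hN => ?_⟩
  obtain ⟨a, ha⟩ : ∃ a, a + ∑ i, μ i = M + 1 + k := ⟨M + 1 + k - ∑ i, μ i, by omega⟩
  obtain ⟨b, rfl⟩ : ∃ b, N = b + k := ⟨N - k, by omega⟩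
  have hlead : LeadsWith (C c * (X 1 ^ a * (X 0 + X 1) ^ b * ∏ i, X (idx i) ^ μ i) :
      MvPolynomial (Fin (n + 1)) ℂ) _ _ :=
    (((one_eq_succ (n := n) ▸ (leadsWith_X_succ 0).pow a).mul
      (leadsWith_X_zero_add_X_one.pow b)).mul
      (leadsWith_prod Finset.univ fun i _ => (leadsWith_X_succ (affIdx i)).pow (μ i))).C_mul hc
  refine ⟨_, ?_, ?_, hlead.degree_eq.trans_lt ?_, ?_⟩
  · have h1 : (X 1 ^ a : MvPolynomial (Fin (n + 1)) ℂ).IsHomogeneous a := isHomogeneous_X_pow _ _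
    have h2 : ((X 0 + X 1) ^ b : MvPolynomial (Fin (n + 1)) ℂ).IsHomogeneous (1 * b) :=
      ((isHomogeneous_X _ _).add (isHomogeneous_X _ _)).pow b
    have h3 : (∏ i, X (idx i) ^ μ i : MvPolynomial (Fin (n + 1)) ℂ).IsHomogeneous (∑ i, μ i) :=
      IsHomogeneous.prod _ _ _ fun i _ => isHomogeneous_X_pow _ _
    have := ((h1.mul h2).mul h3).C_mul c
    convert this using 1
    omega
  · have h0 : (coordFun 0 : RatFun n) ≠ 0 := coordFun_ne_zero 0
    have h1 : (1 + coordFun 0 : RatFun n) ≠ 0 := one_add_coordFun_ne_zero 0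
    have hC : dehom n (C c) = algebraMap ℂ (RatFun n) c := (dehom n).commutes c
    have e := congrArg (fun l => (coordFun 0 : RatFun n) ^ l) ha
    simp only [pow_add] at e
    simp only [map_mul, map_pow, map_prod, map_add, hC, dehom_X_one, idx_eq_succ, dehom_X_succ,
      dehom_X_zero, interp, affCoord, div_pow, Finset.prod_div_distrib, Finset.prod_pow_eq_pow_sum]
    field_simp
    rw [pow_add (1 + coordFun 0 : RatFun n), pow_succ (coordFun 0 : RatFun n) M]
    linear_combination (algebraMap ℂ (RatFun n) c * (1 + coordFun 0) ^ b * (1 + coordFun 0) ^ k *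
      ∏ x, coordFun (affIdx x) ^ μ x) * e
  · simp only [mul_zero, mul_one, zero_add, Finset.sum_const_zero, add_zero]
    exact_mod_cast Nat.lt_add_of_pos_right hk
  · simp only [map_mul, map_pow, map_prod, map_add, restrict_C, restrict_X_one, restrict_X_zero,
      restrict_X_idx, zero_add, one_pow, one_mul]
    rw [monomial_eq, Finsupp.prod_fintype]
    simp

/-- A monomial $\mu$ acquires $t$ to the power $\sum_k\mu_kw_k - d$. This is positive even when
single weights are negative. -/
theorem hasNumerators_of_weight {w : Fin (n - 1) → ℤ} {d : ℤ} {q : MvPolynomial (Fin (n - 1)) ℂ}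
    (hq : ∀ μ ∈ q.support, d < ∑ k, μ k * w k) :
    HasNumerators ((interp n ^ d)⁻¹ * aeval (fun k => interp n ^ w k * affCoord k) q) q := by
  have h := hasNumerators_sum (n := n) q.support
    (u := fun μ => (interp n ^ d)⁻¹ * (algebraMap ℂ (RatFun n) (coeff μ q) *
      ∏ i, (interp n ^ w i * affCoord i) ^ μ i)) (p := fun μ => monomial μ (coeff μ q)) ?_
  · rwa [← Finset.mul_sum, ← eval₂_eq', ← aeval_def, support_sum_monomial_coeff] at h
  intro μ hμ
  obtain ⟨k, hk⟩ := Int.eq_ofNat_of_zero_le (sub_nonneg.2 (hq μ hμ).le)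
  have hk0 : 0 < k := by have := hq μ hμ; omega
  convert hasNumerators_monomial hk0 (mem_support_iff.1 hμ) μ using 1
  have e : (∏ i, (interp n ^ w i) ^ μ i) = interp n ^ (∑ k, μ k * w k) := by
    have hsum : ∀ s : Finset (Fin (n - 1)), (∏ i ∈ s, (interp n ^ w i) ^ μ i) =
        interp n ^ (∑ k ∈ s, μ k * w k) := fun s => by
      classical
      induction s using Finset.induction_on with
      | empty => simp
      | insert i s hi ih =>
        rw [Finset.prod_insert hi, Finset.sum_insert hi, ih, zpow_add₀ interp_ne_zero, mul_comm _ (w i),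
          zpow_mul, zpow_natCast]
    exact hsum _
  simp only [mul_pow, Finset.prod_mul_distrib]
  rw [e, show (∑ k, μ k * w k) = d + k by omega, zpow_add₀ interp_ne_zero, zpow_natCast]
  have := zpow_ne_zero d (interp_ne_zero (n := n))
  field_simp

/-- Over the common denominator $QX_0$ with $Q = X_1^M(X_0+X_1)^M$, the components are $QX_0$,
$QX_1$ and $c_jQX_j + H_j$. Here $H_j$ has $X_0$-degree below $M$, so it is invisible in the leading
term, while $Q = 1$ on the chart makes it reappear in the restriction. -/
theorem tangent_and_restrictsTo_of_scaledComp {w : Fin (n - 1) → ℤ} {ψ : PolyAut (n - 1)}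
    (hψ : IsDiagonalInLowestWeight w ψ) {f : Cremona n} (h0 : pullback f (coordFun 0) = coordFun 0)
    (hj : ∀ j, pullback f (coordFun (affIdx j)) = coordFun 0 * scaledComp w ψ j) :
    IsTangentAtInfinity f ∧ RestrictsTo f ψ := by
  choose c hc hμ using hψ
  choose A hA using fun j => hasNumerators_of_weight (n := n) (hμ j)
  -- The largest of the bounds serves for all `j`, which gives one denominator.
  choose H hH1 hH2 hH3 hH4 using fun j => hA j (Finset.univ.sup A) (Finset.univ.sup A)
    (Finset.le_sup (Finset.mem_univ j)) (Finset.le_sup (Finset.mem_univ j))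
  set M := Finset.univ.sup A
  obtain ⟨Q, hQ⟩ : ∃ Q : MvPolynomial (Fin (n + 1)) ℂ, Q = X 1 ^ M * (X 0 + X 1) ^ M := ⟨_, rfl⟩
  have hQl : LeadsWith Q M (Finsupp.single 0 M) := by
    have := (one_eq_succ (n := n) ▸ (leadsWith_X_succ (0 : Fin n)).pow M).mul
      ((leadsWith_X_zero_add_X_one (n := n)).pow M)
    simpa [hQ] using this
  have hQh : Q.IsHomogeneous (M + M) := by
    have h2 : ((X 0 + X 1) ^ M : MvPolynomial (Fin (n + 1)) ℂ).IsHomogeneous (1 * M) :=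
      ((isHomogeneous_X _ _).add (isHomogeneous_X _ _)).pow M
    rw [one_mul] at h2
    rw [hQ]
    exact (isHomogeneous_X_pow _ _).mul h2
  have hQr : restrict n Q = 1 := by simp [hQ]
  have hQd : dehom n Q = coordFun 0 ^ M * (1 + coordFun 0) ^ M := by
    simp [hQ]
  have hQ0 : dehom n Q ≠ 0 := dehom_ne_zero hQh hQl.ne_zero
  set F : Fin (n + 1) → MvPolynomial (Fin (n + 1)) ℂ := Fin.cons (Q * X 0)
    (affCons (Q * X 1) fun j => C (c j) * (Q * X (idx j)) + H j) with hF
  have hF0 : F 0 = Q * X 0 := rfl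
  have hF1 : F 1 = Q * X 1 := by rw [hF, one_eq_succ, Fin.cons_succ, affCons_zero]
  have hFj : ∀ j, F (idx j) = C (c j) * (Q * X (idx j)) + H j := fun j => by
    rw [hF, idx_eq_succ, Fin.cons_succ, affCons_affIdx, idx_eq_succ]
  have hrep : Represents f F := by
    refine ⟨⟨M + M + 1, fun i => ?_⟩, ?_, fun i => ?_⟩
    · obtain rfl | rfl | ⟨j, rfl⟩ := eq_zero_or_one_or_idx i
      · exact hF0 ▸ hQh.mul (isHomogeneous_X _ _)
      · exact hF1 ▸ hQh.mul (isHomogeneous_X _ _)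
      · rw [hFj]
        exact ((hQh.mul (isHomogeneous_X _ _)).C_mul _).add (hH1 j)
    · exact hF0 ▸ mul_ne_zero hQl.ne_zero (X_ne_zero 0)
    · obtain rfl | ⟨j, rfl⟩ := eq_zero_or_affIdx i
      · rw [← one_eq_succ, hF0, hF1, h0, map_mul, map_mul, dehom_X_one, dehom_X_zero, mul_one,
          mul_div_cancel_left₀ _ hQ0]
      · have hC : dehom n (C (c j)) = algebraMap ℂ (RatFun n) (c j) := (dehom n).commutes (c j)
        rw [← idx_eq_succ, hF0, hFj, hj, map_add, map_mul, map_mul, map_mul, hH2, idx_eq_succ,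
          dehom_X_succ, dehom_X_zero, mul_one, hC, eq_div_iff hQ0]
        have e : scaledComp w ψ j = algebraMap ℂ (RatFun n) (c j) * affCoord j +
            (interp n ^ w j)⁻¹ *
              aeval (fun k => interp n ^ w k * affCoord k) (comp ψ j - C (c j) * X j) := by
          have := zpow_ne_zero (w j) (interp_ne_zero (n := n))
          rw [scaledComp, map_sub, map_mul, aeval_C, aeval_X]
          field_simp
          ring
        rw [e, ← coordFun_zero_mul_affCoord, hQd]
        ring
  refine ⟨⟨F, Fin.cons (Finsupp.single 0 M) fun j => Finsupp.single 0 M + Finsupp.single j 1,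
    ⟨hrep, M, ?_, fun i => ?_⟩, fun j => by simp⟩, F, hrep, ?_, ?_, fun j => ?_⟩
  · simpa [hF0] using hQl.mul leadsWith_X_zero
  · rw [Fin.cons_succ]
    obtain rfl | ⟨j, rfl⟩ := eq_zero_or_affIdx i
    · rw [← one_eq_succ, hF1, one_eq_succ]
      simpa using hQl.mul (leadsWith_X_succ (0 : Fin n))
    · rw [← idx_eq_succ, hFj, idx_eq_succ]
      exact LeadsWith.add_of_degree_lt
        (by simpa using (hQl.mul (leadsWith_X_succ (affIdx j))).C_mul (hc j)) (hH3 j)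
  · simp [hF0]
  · simp [hF1, hQr]
  · rw [hFj, hF1, map_add, map_mul, map_mul, map_mul, hH4, hQr, restrict_C, restrict_X_idx,
      restrict_X_one]
    ring

theorem exists_kerRho_restrictsTo_of_weight {w : Fin (n - 1) → ℤ} {ψ : PolyAut (n - 1)}
    (hψ : IsDiagonalInLowestWeight w ψ) (hψ' : IsDiagonalInLowestWeight w ψ⁻¹) :
    ∃ f ∈ kerRho n, RestrictsTo f ψ := by
  obtain ⟨f, ⟨h0, hj⟩, h0', hj'⟩ := exists_cremona_scaledComp w ψ
  obtain ⟨h1, h2⟩ := tangent_and_restrictsTo_of_scaledComp hψ h0 hj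
  exact ⟨f, (mem_kerRho_iff f).2 ⟨h1, (tangent_and_restrictsTo_of_scaledComp hψ' h0' hj').1⟩, h2⟩

end Scaling

/-! ### Decomposition of polynomial automorphisms. -/

section PolynomialAutomorphisms

variable {m : ℕ}

/-- The polynomial automorphism with the components `P` and with an inverse with the
components `Q`. -/
def polyAutOf (P Q : Fin m → MvPolynomial (Fin m) ℂ) (h : ∀ j, aeval P (Q j) = X j)
    (h' : ∀ j, aeval Q (P j) = X j) : PolyAut m :=
  MulOpposite.op (AlgEquiv.ofAlgHom (aeval P) (aeval Q)
    (MvPolynomial.algHom_ext fun j => by simpa using h j)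
    (MvPolynomial.algHom_ext fun j => by simpa using h' j))

@[simp] theorem comp_polyAutOf (P Q : Fin m → MvPolynomial (Fin m) ℂ) (h : ∀ j, aeval P (Q j) = X j)
    (h' : ∀ j, aeval Q (P j) = X j) (j : Fin m) : comp (polyAutOf P Q h h') j = P j :=
  aeval_X P j

@[simp] theorem comp_inv_polyAutOf (P Q : Fin m → MvPolynomial (Fin m) ℂ)
    (h : ∀ j, aeval P (Q j) = X j) (h' : ∀ j, aeval Q (P j) = X j) (j : Fin m) :
    comp (polyAutOf P Q h h')⁻¹ j = Q j :=
  aeval_X Q j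

/-- The translation by `b`. -/
def translation (b : Fin m → ℂ) : PolyAut m :=
  polyAutOf (fun j => X j + C (b j)) (fun j => X j - C (b j)) (fun j => by simp [algebraMap_eq])
    fun j => by simp [algebraMap_eq]

theorem comp_translation (b : Fin m → ℂ) (j : Fin m) :
    comp (translation b) j = X j + C (b j) := comp_polyAutOf _ _ _ _ j

theorem comp_inv_translation (b : Fin m → ℂ) (j : Fin m) :
    comp (translation b)⁻¹ j = X j - C (b j) := comp_inv_polyAutOf _ _ _ _ j

theorem aeval_linear (A B : Matrix (Fin m) (Fin m) ℂ) (j : Fin m) :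
    aeval (fun j => ∑ k, C (A j k) * X k : Fin m → MvPolynomial (Fin m) ℂ)
      (∑ k, C (B j k) * X k : MvPolynomial (Fin m) ℂ) = ∑ k, C ((B * A) j k) * X k := by
  simp only [map_sum, map_mul, aeval_C, aeval_X, algebraMap_eq, Matrix.mul_apply, Finset.mul_sum,
    Finset.sum_mul]
  rw [Finset.sum_comm]
  simp only [mul_assoc]

theorem sum_C_one_mul_X (j : Fin m) :
    (∑ k, C ((1 : Matrix (Fin m) (Fin m) ℂ) j k) * X k : MvPolynomial (Fin m) ℂ) = X j := by
  rw [Finset.sum_eq_single j]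
  · simp
  · intro k _ hk
    simp [Matrix.one_apply_ne hk.symm]
  · simp

/-- The linear automorphism with the matrix `A`. -/
def linAut (A : GL (Fin m) ℂ) : PolyAut m :=
  polyAutOf (fun j => ∑ k, C (A.1 j k) * X k) (fun j => ∑ k, C (A⁻¹.1 j k) * X k)
    (fun j => by rw [aeval_linear, ← Units.val_mul, inv_mul_cancel, Units.val_one, sum_C_one_mul_X])
    fun j => by rw [aeval_linear, ← Units.val_mul, mul_inv_cancel, Units.val_one, sum_C_one_mul_X]

theorem comp_linAut (A : GL (Fin m) ℂ) (j : Fin m) :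
    comp (linAut A) j = ∑ k, C (A.1 j k) * X k := comp_polyAutOf _ _ _ _ j

theorem linAut_inv (A : GL (Fin m) ℂ) : (linAut A)⁻¹ = linAut A⁻¹ :=
  PolyAut.ext fun j => by
    rw [comp_linAut, linAut, comp_inv_polyAutOf]

theorem linAut_mul (A B : GL (Fin m) ℂ) : linAut (A * B) = linAut A * linAut B :=
  PolyAut.ext fun j => by
    rw [comp_mul, comp_linAut, comp_linAut, Units.val_mul, ← aeval_linear]
    rfl

/-- With all weights $-1$, constants have weight $0 > -1$. -/
theorem isDiagonalInLowestWeight_translation (b : Fin m → ℂ) :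
    IsDiagonalInLowestWeight (fun _ => -1) (translation b) := by
  refine fun j => ⟨1, one_ne_zero, fun μ hμ => ?_⟩
  rw [comp_translation, C_1, one_mul, add_sub_cancel_left, mem_support_iff, coeff_C] at hμ
  have h0 : μ = 0 := by
    by_contra h
    exact hμ (if_neg (Ne.symm h))
  simp [h0]

theorem translation_inv (b : Fin m → ℂ) : (translation b)⁻¹ = translation (-b) :=
  PolyAut.ext fun j => by
    rw [comp_inv_translation, comp_translation, Pi.neg_apply, map_neg, sub_eq_add_neg]

theorem isDiagonalInLowestWeight_linAut {w : Fin m → ℤ} {A : GL (Fin m) ℂ}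
    (hd : ∀ j, A.1 j j ≠ 0) (hw : ∀ j k, k ≠ j → A.1 j k ≠ 0 → w j < w k) :
    IsDiagonalInLowestWeight w (linAut A) := by
  refine fun j => ⟨A.1 j j, hd j, fun μ hμ => ?_⟩
  rw [comp_linAut, ← Finset.add_sum_erase _ _ (Finset.mem_univ j), add_sub_cancel_left,
    mem_support_iff, coeff_sum] at hμ
  obtain ⟨k, hk, hne⟩ := Finset.exists_ne_zero_of_sum_ne_zero hμ
  rw [coeff_C_mul, coeff_X] at hne
  have h1 := left_ne_zero_of_mul hne
  have h2 : Finsupp.single k 1 = μ := by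
    by_contra h
    exact right_ne_zero_of_mul hne (if_neg h)
  subst h2
  simpa [Finsupp.single_apply] using hw j k (Finset.ne_of_mem_erase hk) h1

/-- Automorphisms that agree with the identity up to terms of degree at least two. -/
def IsTangentToId (ψ : PolyAut m) : Prop :=
  (∀ j, constantCoeff (comp ψ j) = 0) ∧ (jacobian ψ).map constantCoeff = 1

theorem constantCoeff_unop {ψ : PolyAut m} (h : ∀ j, constantCoeff (comp ψ j) = 0)
    (p : MvPolynomial (Fin m) ℂ) : constantCoeff (ψ.unop p) = constantCoeff p := by
  induction p using MvPolynomial.induction_on with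
  | C a => rw [show ψ.unop (C a) = C a from ψ.unop.commutes a]
  | add p q hp hq => simp [hp, hq]
  | mul_X p i hp =>
    rw [map_mul, map_mul, show constantCoeff (ψ.unop (X i)) = 0 from h i]
    simp

/-- The chain rule for `ψ⁻¹ * ψ = 1`, evaluated at the origin, which `ψ` fixes. -/
theorem IsTangentToId.inv {ψ : PolyAut m} (h : IsTangentToId ψ) : IsTangentToId ψ⁻¹ := by
  refine ⟨fun j => ?_, ?_⟩
  · rw [← constantCoeff_unop h.1]
    have : ψ.unop (comp ψ⁻¹ j) = X j := ψ.unop.apply_symm_apply (X j)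
    rw [this, constantCoeff_X]
  · have h1 : jacobian (1 : PolyAut m) = 1 := by
      ext1 i j
      simp [jacobian, comp, pderiv_X, Matrix.one_apply, Pi.single_apply]
    have h2 := jacobian_mul ψ⁻¹ ψ
    rw [inv_mul_cancel, h1] at h2
    have h3 := congrArg (fun M : Matrix _ _ _ => M.map constantCoeff) h2
    simp only [Matrix.map_mul, h.2, Matrix.mul_one, Matrix.map_map] at h3
    rw [Matrix.map_one _ (map_zero _) (map_one _)] at h3
    rw [h3]
    ext i j
    exact (constantCoeff_unop h.1 _).symm

/-- With all weights $1$ the weight is the degree. The constant and linear coefficients of $\psi_j -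
x_j$ vanish by the two halves of the hypothesis. -/
theorem IsTangentToId.isDiagonalInLowestWeight {ψ : PolyAut m} (h : IsTangentToId ψ) :
    IsDiagonalInLowestWeight (fun _ => 1) ψ := by
  refine fun j => ⟨1, one_ne_zero, fun μ hμ => ?_⟩
  by_contra hle
  rw [C_1, one_mul, mem_support_iff, coeff_sub] at hμ
  have hdeg : (∑ k, μ k) ≤ 1 := by
    have : ((∑ k, μ k : ℕ) : ℤ) ≤ 1 := by push_cast; simpa using hle
    exact_mod_cast this
  rcases Nat.le_one_iff_eq_zero_or_eq_one.1 hdeg with h0 | h0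
  · have hz : μ = 0 := by
      ext k
      exact (Finset.sum_eq_zero_iff.1 h0) k (Finset.mem_univ k)
    apply hμ
    have h2 : coeff 0 (comp ψ j) = 0 := h.1 j
    rw [hz, h2, coeff_zero_X, sub_zero]
  · rw [← Finsupp.sum_fintype μ (fun _ a => a) fun _ => rfl] at h0
    obtain ⟨k, rfl⟩ := (Finsupp.sum_eq_one_iff _).1 h0
    have h1 := congrFun (congrFun h.2 j) k
    simp only [jacobian, Matrix.map_apply, Matrix.of_apply, constantCoeff_eq, coeff_pderiv,
      zero_add, Finsupp.coe_zero, Pi.zero_apply, Nat.cast_zero, mul_one] at h1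
    apply hμ
    rw [h1, coeff_X, Matrix.one_apply, sub_eq_zero]
    simp [Finsupp.single_left_inj]

/-- Here $b = \varphi(0)$, $A$ is the Jacobi matrix at $0$ and $\psi = A^{-1}(\varphi - b)$.
Determinant $1$ serves only to make $A$ invertible. -/
theorem exists_translation_mul_linAut_mul {φ : PolyAut m} (hφ : φ ∈ SAut m) :
    ∃ b A ψ, IsTangentToId ψ ∧ φ = translation b * (linAut A * ψ) := by
  set b : Fin m → ℂ := fun j => constantCoeff (comp φ j) with hb
  have hdet : ((jacobian φ).map constantCoeff).det ≠ 0 := by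
    have h1 : (jacobian φ).det = 1 := hφ
    have h2 := RingHom.map_det (constantCoeff : MvPolynomial (Fin m) ℂ →+* ℂ) (jacobian φ)
    rw [h1, map_one] at h2
    rw [← RingHom.mapMatrix_apply, ← h2]
    exact one_ne_zero
  set A : GL (Fin m) ℂ := Matrix.GeneralLinearGroup.mkOfDetNeZero _ hdet with hA
  have hcomp : ∀ j, comp ((linAut A)⁻¹ * ((translation b)⁻¹ * φ)) j =
      ∑ k, C (A⁻¹.1 j k) * (comp φ k - C (b k)) := fun j => by
    have hC : ∀ c, ((translation b)⁻¹ * φ).unop (C c) = C c :=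
      fun c => ((translation b)⁻¹ * φ).unop.commutes c
    have hX : ∀ k, ((translation b)⁻¹ * φ).unop (X k) = comp φ k - C (b k) := fun k => by
      change comp ((translation b)⁻¹ * φ) k = _
      rw [comp_mul, comp_inv_translation, map_sub, show φ.unop (C (b k)) = C (b k) from
        φ.unop.commutes _]
      rfl
    rw [comp_mul, linAut_inv, comp_linAut, map_sum]
    simp only [map_mul, hC, hX]
  refine ⟨b, A, (linAut A)⁻¹ * ((translation b)⁻¹ * φ), ⟨fun j => ?_, ?_⟩, by group⟩
  · rw [hcomp, map_sum]
    simp [hb]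
  · have h1 : (jacobian ((linAut A)⁻¹ * ((translation b)⁻¹ * φ))).map constantCoeff =
        A⁻¹.1 * A.1 := by
      ext i j
      simp only [jacobian, Matrix.map_apply, Matrix.of_apply, hcomp, Matrix.mul_apply, map_sum,
        pderiv_C_mul, map_sub, pderiv_C, sub_zero, map_mul, constantCoeff_C]
      rfl
    rw [h1, ← Units.val_mul, inv_mul_cancel, Units.val_one]

end PolynomialAutomorphisms

/-! ### Surjectivity of the restriction. -/

section Lifting

variable (n : ℕ) [NeZero n]

/-- The polynomial automorphisms that are restrictions of elements of the kernel of `ρ`. -/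
def liftable : Submonoid (PolyAut (n - 1)) where
  carrier := {φ | ∃ f ∈ kerRho n, RestrictsTo f φ}
  one_mem' := ⟨1, (kerRhoSubgroup n).one_mem, restrictsTo_one n⟩
  mul_mem' := by
    rintro φ ψ ⟨f, hf, h⟩ ⟨g, hg, h'⟩
    exact ⟨f * g, (kerRhoSubgroup n).mul_mem hf hg, h.mul h'⟩

theorem mem_liftable_of_weight {w : Fin (n - 1) → ℤ} {ψ : PolyAut (n - 1)}
    (hψ : IsDiagonalInLowestWeight w ψ) (hψ' : IsDiagonalInLowestWeight w ψ⁻¹) :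
    ψ ∈ liftable n := exists_kerRho_restrictsTo_of_weight hψ hψ'

theorem translation_mem_liftable (b : Fin (n - 1) → ℂ) : translation b ∈ liftable n := by
  refine mem_liftable_of_weight n (isDiagonalInLowestWeight_translation b) ?_
  rw [translation_inv]
  exact isDiagonalInLowestWeight_translation (-b)

/-- No single weight vector serves all matrices, so each generator gets its own. The factors need
not have determinant $1$, which is why `liftable` ignores the Jacobian. -/
theorem linAut_mem_liftable (A : GL (Fin (n - 1)) ℂ) : linAut A ∈ liftable n := by
  suffices h : ∀ M : Matrix (Fin (n - 1)) (Fin (n - 1)) ℂ, M.det ≠ 0 →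
      ∀ A : GL (Fin (n - 1)) ℂ, A.1 = M → linAut A ∈ liftable n from
    h A.1 ((Matrix.isUnit_iff_isUnit_det _).1 A.isUnit).ne_zero A rfl
  intro M hM
  refine Matrix.diagonal_transvection_induction_of_det_ne_zero
    (fun M => ∀ A : GL (Fin (n - 1)) ℂ, A.1 = M → linAut A ∈ liftable n) M hM ?_ ?_ ?_
  · intro D hD A hA
    have hmul : ∀ j k, D j * A⁻¹.1 j k = (1 : Matrix _ _ ℂ) j k := fun j k => by
      rw [← Matrix.diagonal_mul, ← hA, ← Units.val_mul, mul_inv_cancel, Units.val_one]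
    have hD0 : ∀ j, D j ≠ 0 := fun j h => by
      have := hmul j j
      rw [h, zero_mul, Matrix.one_apply_eq] at this
      exact zero_ne_one this
    refine mem_liftable_of_weight n (w := 0)
      (isDiagonalInLowestWeight_linAut (fun j => ?_) fun j k hk h => ?_) ?_
    · rw [hA, Matrix.diagonal_apply_eq]; exact hD0 j
    · rw [hA, Matrix.diagonal_apply_ne _ hk.symm] at h
      exact absurd rfl h
    rw [linAut_inv]
    refine isDiagonalInLowestWeight_linAut (fun j h => ?_) fun j k hk h => ?_
    · have := hmul j j
      rw [h, mul_zero, Matrix.one_apply_eq] at this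
      exact zero_ne_one this
    · have := hmul j k
      rw [Matrix.one_apply_ne hk.symm] at this
      exact absurd this (mul_ne_zero (hD0 j) h)
  · intro t A hA
    -- A transvection adds a multiple of $x_{s.j}$ to $x_{s.i}$, so $x_{s.j}$ must be the heavier
    -- variable. The inverse has the same indices, hence the same weights work.
    have key : ∀ (s : Matrix.TransvectionStruct (Fin (n - 1)) ℂ) (B : GL (Fin (n - 1)) ℂ),
        B.1 = s.toMatrix → IsDiagonalInLowestWeight (Pi.single s.j 1) (linAut B) := by
      intro s B hB
      refine isDiagonalInLowestWeight_linAut (fun j => ?_) fun j k hk h => ?_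
      · rw [hB, Matrix.TransvectionStruct.toMatrix, Matrix.transvection, Matrix.add_apply,
          Matrix.one_apply_eq, Matrix.single_apply, if_neg fun h => s.hij (h.1.trans h.2.symm)]
        simp
      · rw [hB, Matrix.TransvectionStruct.toMatrix, Matrix.transvection, Matrix.add_apply,
          Matrix.one_apply_ne hk.symm, Matrix.single_apply, zero_add] at h
        have h' : s.i = j ∧ s.j = k := by
          by_contra h'
          exact h (if_neg h')
        rw [← h'.1, ← h'.2, Pi.single_eq_same, Pi.single_eq_of_ne s.hij]
        exact zero_lt_one
    have hinv : A⁻¹.1 = t.inv.toMatrix := by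
      have h1 := t.inv_mul
      rw [← hA] at h1
      exact (left_inv_eq_right_inv h1 A.mul_inv).symm
    refine mem_liftable_of_weight n (key t A hA) ?_
    rw [linAut_inv]
    exact key t.inv A⁻¹ hinv
  · intro M N hM hN ihM ihN A hA
    have : A = Matrix.GeneralLinearGroup.mkOfDetNeZero M hM *
        Matrix.GeneralLinearGroup.mkOfDetNeZero N hN := Units.ext hA
    rw [this, linAut_mul]
    exact (liftable n).mul_mem (ihM _ rfl) (ihN _ rfl)

theorem exists_kerRho_restrictsTo {φ : PolyAut (n - 1)} (hφ : φ ∈ SAut (n - 1)) :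
    ∃ f ∈ kerRho n, RestrictsTo f φ := by
  obtain ⟨b, A, ψ, hψ, rfl⟩ := exists_translation_mul_linAut_mul hφ
  exact (liftable n).mul_mem (translation_mem_liftable n b) ((liftable n).mul_mem
    (linAut_mem_liftable n A) (mem_liftable_of_weight n hψ.isDiagonalInLowestWeight
      hψ.inv.isDiagonalInLowestWeight))

theorem restrictHom_surjective : Function.Surjective (restrictHom n) := by
  rintro ⟨φ, hφ⟩
  obtain ⟨f, hf, h⟩ := exists_kerRho_restrictsTo n hφ
  refine ⟨⟨f, hf, φ, hφ, h⟩, Subtype.ext ?_⟩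
  exact (restrictsTo_restrictHom _).unique h

end Lifting

end CremonaGrp

end

open CremonaGrp in
theorem proposition3p1 (n : ℕ) (hn : 3 ≤ n) :
    ∃ S : Subgroup (Cremona n),
      (S : Set (Cremona n)) ⊆ kerRho n ∧
      (∀ f ∈ kerRho n, HasTypicalForm f →
        ∀ φ ∈ SAut (n - 1), RestrictsTo f φ → f ∈ S) ∧
      ∃ ξ : S →* SAut (n - 1), Function.Surjective ξ ∧
        ∀ f : S, RestrictsTo (f : Cremona n) (ξ f : PolyAut (n - 1)) := by
  have : NeZero n := ⟨by omega⟩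
  exact ⟨restrictingSubgroup n, fun f hf => hf.1, fun f hf _ φ hφ h => ⟨hf, φ, hφ, h⟩,
    restrictHom n, restrictHom_surjective n, restrictsTo_restrictHom⟩
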